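/- Let $H$ be a complex separable Hilbert space and let $T\in\mathcal L(H)$ be a bounded linear operator. Call $T$ *finite* if $$0\in\overline{W(TX-XT)}\quad\text{for all }X\in\mathcal L(H),$$ where $W(A)=\{\langle Ax,x\rangle : x\in H,\ \|x\|=1\}$ is the numerical range of $A$ and the bar denotes closure in $\mathbb C$. Call $T$ *finite block reducible* if there is an orthogonal decomposition $H=H_0\oplus H_1$ reducing $T$ (that is, $TH_0\subseteq H_0$ and $TH_1\subseteq H_1$) with $H_0$ finite-dimensional and non-zero. A *proper Følner sequence* for $T$ is an increasing sequence $(P_n)_{n\in\mathbb N}$ of non-zero finite-rank orthogonal projections on $H$ which converges strongly to the identity and satisfies $$\lim_{n\to\infty}\frac{\|TP_n-P_nT\|_2}{\|P_n\|_2}=0,$$ where $\|\cdot\|_2$ is the Hilbert–Schmidt norm. **Theorem 4.1.** $T$ is finite if and only if $T$ is finite block reducible or $T$ has a proper Følner sequence. -/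

import Mathlib

open Filter Topology
open scoped ENNReal InnerProductSpace

namespace FiniteOperators

variable {H : Type*} [NormedAddCommGroup H] [InnerProductSpace ℂ H]

/-- The numerical range `W(T) = {⟨Tx, x⟩ : ‖x‖ = 1}`. The inner product here is linear in the
first variable, whereas Mathlib's `⟪·, ·⟫_ℂ` is linear in the second one, so `⟨Tx, x⟩` is
`⟪x, T x⟫_ℂ`. -/
def numericalRange (T : H →L[ℂ] H) : Set ℂ :=
  {z | ∃ x : H, ‖x‖ = 1 ∧ ⟪x, T x⟫_ℂ = z}

/-- `T` is a finite operator in the sense of Williams. -/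
def IsFiniteOperator (T : H →L[ℂ] H) : Prop :=
  ∀ X : H →L[ℂ] H, (0 : ℂ) ∈ closure (numericalRange (T * X - X * T))

/-- `T` is finite block reducible: there is a non-zero finite-dimensional subspace `H₀` such that
the orthogonal decomposition `H = H₀ ⊕ H₀ᗮ` reduces `T`. -/
def IsFiniteBlockReducible (T : H →L[ℂ] H) : Prop :=
  ∃ H₀ : Submodule ℂ H, H₀ ≠ ⊥ ∧ FiniteDimensional ℂ H₀ ∧
    (∀ x ∈ H₀, T x ∈ H₀) ∧ (∀ x ∈ H₀ᗮ, T x ∈ H₀ᗮ)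

theorem tsum_enorm_inner_sq {ι : Type*} (b : HilbertBasis ι ℂ H) (x : H) :
    ∑' i, ‖⟪x, b i⟫_ℂ‖ₑ ^ 2 = ‖x‖ₑ ^ 2 := by
  have h := (b.hasSum_inner_mul_inner x x).mapL Complex.reCLM
  have e : ∀ i, Complex.reCLM (⟪x, b i⟫_ℂ * ⟪b i, x⟫_ℂ) = ‖⟪x, b i⟫_ℂ‖ ^ 2 := fun i => by
    rw [← inner_conj_symm (b i) x, Complex.reCLM_apply, RCLike.mul_conj]
    norm_cast
  have e' : Complex.reCLM ⟪x, x⟫_ℂ = ‖x‖ ^ 2 := by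
    rw [Complex.reCLM_apply, inner_self_eq_norm_sq_to_K]
    norm_cast
  simp only [e, e'] at h
  have := ENNReal.ofReal_tsum_of_nonneg (fun i => sq_nonneg ‖⟪x, b i⟫_ℂ‖) h.summable
  rw [h.tsum_eq] at this
  simpa [ENNReal.ofReal_pow] using this.symm

variable [CompleteSpace H]

variable (H) in
/-- The index set of some orthonormal (Hilbert) basis of `H`. -/
def basisIndex : Set H := (exists_hilbertBasis ℂ H).choose

variable (H) in
/-- Some orthonormal (Hilbert) basis of `H`. -/
noncomputable def someBasis : HilbertBasis (basisIndex H) ℂ H :=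
  (exists_hilbertBasis ℂ H).choose_spec.choose

/-- The Hilbert-Schmidt norm `‖A‖₂ = (∑ᵢ ‖A eᵢ‖²)^(1/2)`, where `(eᵢ)` is an orthonormal basis,
with values in `[0, ∞]`. It does not depend on the basis: see `hsNorm_eq`. -/
noncomputable def hsNorm (A : H →L[ℂ] H) : ℝ≥0∞ :=
  (∑' i, ‖A (someBasis H i)‖ₑ ^ 2) ^ (1 / 2 : ℝ)

theorem tsum_enorm_sq_adjoint {ι κ : Type*} (b : HilbertBasis ι ℂ H) (c : HilbertBasis κ ℂ H)
    (A : H →L[ℂ] H) :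
    ∑' i, ‖A (b i)‖ₑ ^ 2 = ∑' j, ‖ContinuousLinearMap.adjoint A (c j)‖ₑ ^ 2 := by
  simp_rw [← tsum_enorm_inner_sq c (A _), ← tsum_enorm_inner_sq b (ContinuousLinearMap.adjoint A _)]
  rw [ENNReal.tsum_comm]
  refine tsum_congr fun j => tsum_congr fun i => ?_
  rw [ContinuousLinearMap.adjoint_inner_left, ← inner_conj_symm, RCLike.enorm_conj]

/-- The Hilbert-Schmidt norm can be computed in any orthonormal basis. -/
theorem hsNorm_eq {ι : Type*} (b : HilbertBasis ι ℂ H) (A : H →L[ℂ] H) :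
    hsNorm A = (∑' i, ‖A (b i)‖ₑ ^ 2) ^ (1 / 2 : ℝ) := by
  rw [hsNorm, tsum_enorm_sq_adjoint (someBasis H) b, ← tsum_enorm_sq_adjoint b b]

/-- `P` is a non-zero orthogonal projection of finite rank. -/
def IsFiniteRankProjection (P : H →L[ℂ] H) : Prop :=
  P ≠ 0 ∧ IsStarProjection P ∧ FiniteDimensional ℂ (LinearMap.range (P : H →ₗ[ℂ] H))

/-- `P` is a Følner sequence for the set `𝒯` of operators. -/
def IsFolnerSequence (𝒯 : Set (H →L[ℂ] H)) (P : ℕ → H →L[ℂ] H) : Prop :=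
  (∀ n, IsFiniteRankProjection (P n)) ∧
    ∀ T ∈ 𝒯, Tendsto (fun n => hsNorm (T * P n - P n * T) / hsNorm (P n)) atTop (𝓝 0)

/-- `P` is a proper Følner sequence for `𝒯`: a Følner sequence that is increasing (for the usual
order of self-adjoint operators) and converges strongly to the identity. -/
def IsProperFolnerSequence (𝒯 : Set (H →L[ℂ] H)) (P : ℕ → H →L[ℂ] H) : Prop :=
  IsFolnerSequence 𝒯 P ∧ Monotone P ∧ ∀ x : H, Tendsto (fun n => P n x) atTop (𝓝 x)

/-- The single operator `T` has a proper Følner sequence. -/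
def HasProperFolnerSequence (T : H →L[ℂ] H) : Prop :=
  ∃ P : ℕ → H →L[ℂ] H, IsProperFolnerSequence {T} P

end FiniteOperators

/-! Both alternatives on the right give finite-rank projections `P` with `‖TP - PT‖₂ / ‖P‖₂` as
small as desired; a reducing finite-dimensional subspace even gives commutator zero. For such a `P`,
the normalized trace of `P(TX - XT)P` is small, because the trace of a commutator of compressions
vanishes. By the Toeplitz-Hausdorff theorem this normalized trace, an average of values of the
quadratic form, lies in the numerical range, so `T` is finite.

Conversely, let `T` be finite. No commutator `TX - XT` is strictly accretive, so Hahn-Banach yields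
a hypertrace: a positive functional `f` vanishing on all these commutators. If `f` is non-zero on
some rank one operator, its restriction to rank one operators is represented by a non-zero positive
trace class operator commuting with `T`. The spectral subspaces of that operator above a positive
level are finite-dimensional and reduce `T` (`isFiniteBlockReducible_of_commute`).

If `T` is not finite block reducible, `f` therefore kills every finite-rank operator. A commutator
can then not be strictly accretive even on the complement of a finite-dimensional `F`. A second
Hahn-Banach argument turns this into finite-rank densities supported in `Fᗮ` that almost commute
with `T` in trace norm (`IsFiniteOperator.exists_almost_commuting_density`).

To pass from densities to projections, the real and imaginary parts of `T` are replaced by their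
Cayley transforms. For a unitary, the Powers-Størmer inequality and Connes's level set trick show
that an almost invariant density has an almost invariant spectral projection; averaging over levels
handles both unitaries at once (`exists_subfamily_almost_commuting`). Since these projections live
in `Fᗮ` for arbitrary `F`, orthogonal sums of them can be made large enough to absorb any given
finite-dimensional subspace. Exhausting a dense sequence then gives a proper Følner sequence. -/

namespace FiniteOperators

/-! ### Finite orthonormal families and Hilbert-Schmidt estimates. -/

variable {H : Type*} [NormedAddCommGroup H] [InnerProductSpace ℂ H]

/-- The orthogonal projection onto the span of a finite orthonormal family. -/
theorem starProjection_apply_of_span_eq {ι : Type*} [Fintype ι] {e : ι → H}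
    (he : Orthonormal ℂ e) {V : Submodule ℂ H} [V.HasOrthogonalProjection]
    (hV : Submodule.span ℂ (Set.range e) = V) (x : H) :
    V.starProjection x = ∑ i, ⟪e i, x⟫_ℂ • e i := by
  refine Submodule.eq_starProjection_of_mem_of_inner_eq_zero (K := V) ?_ ?_
  · rw [← hV]
    exact Submodule.sum_mem _ fun i _ => Submodule.smul_mem _ _ (Submodule.subset_span ⟨i, rfl⟩)
  · intro w hw
    rw [← hV] at hw
    induction hw using Submodule.span_induction with
    | mem w hw =>
      obtain ⟨j, rfl⟩ := hw
      classical
      rw [inner_sub_left, sum_inner]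
      simp [inner_smul_left, orthonormal_iff_ite.mp he]
    | zero => simp
    | add a b _ _ ha hb => rw [inner_add_right, ha, hb, add_zero]
    | smul c a _ ha => rw [inner_smul_right, ha, mul_zero]

theorem span_range_stdOrthonormalBasis (V : Submodule ℂ H) [FiniteDimensional ℂ V] :
    Submodule.span ℂ (Set.range fun i => (stdOrthonormalBasis ℂ V i : H)) = V := by
  have h := (stdOrthonormalBasis ℂ V).toBasis.span_eq
  have h2 := congrArg (Submodule.map V.subtype) h
  rw [Submodule.map_span, ← Set.range_comp, Submodule.map_subtype_top] at h2
  simpa [Function.comp_def] using h2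

theorem orthonormal_coe_stdOrthonormalBasis (V : Submodule ℂ H) [FiniteDimensional ℂ V] :
    Orthonormal ℂ fun i => (stdOrthonormalBasis ℂ V i : H) :=
  (stdOrthonormalBasis ℂ V).orthonormal.comp_linearIsometry V.subtypeₗᵢ

section HilbertSchmidt

variable [CompleteSpace H]

/-- The square of the Hilbert-Schmidt norm. -/
noncomputable def hsSq (A : H →L[ℂ] H) : ℝ≥0∞ :=
  ∑' i, ‖A (someBasis H i)‖ₑ ^ 2

theorem hsNorm_eq_rpow (A : H →L[ℂ] H) : hsNorm A = hsSq A ^ (1 / 2 : ℝ) := rfl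

theorem hsSq_adjoint (A : H →L[ℂ] H) : hsSq (ContinuousLinearMap.adjoint A) = hsSq A :=
  (tsum_enorm_sq_adjoint (someBasis H) (someBasis H) A).symm

theorem hsSq_neg (A : H →L[ℂ] H) : hsSq (-A) = hsSq A := by
  simp [hsSq]

theorem hsSq_smul (c : ℂ) (A : H →L[ℂ] H) : hsSq (c • A) = ‖c‖ₑ ^ 2 * hsSq A := by
  simp [hsSq, enorm_smul, mul_pow, ENNReal.tsum_mul_left]

theorem enorm_add_sq_le {E : Type*} [SeminormedAddCommGroup E] (x y : E) :
    ‖x + y‖ₑ ^ 2 ≤ 2 * ‖x‖ₑ ^ 2 + 2 * ‖y‖ₑ ^ 2 := by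
  have h : ‖x + y‖ ^ 2 ≤ 2 * ‖x‖ ^ 2 + 2 * ‖y‖ ^ 2 := by
    have := norm_add_le x y
    nlinarith [norm_nonneg (x + y), sq_nonneg (‖x‖ - ‖y‖)]
  simp only [← ofReal_norm]
  rw [← ENNReal.ofReal_pow (norm_nonneg _), ← ENNReal.ofReal_pow (norm_nonneg _),
    ← ENNReal.ofReal_pow (norm_nonneg _), show (2 : ℝ≥0∞) = ENNReal.ofReal 2 by simp,
    ← ENNReal.ofReal_mul (by norm_num), ← ENNReal.ofReal_mul (by norm_num),
    ← ENNReal.ofReal_add (by positivity) (by positivity)]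
  exact ENNReal.ofReal_le_ofReal h

theorem hsSq_add_le (A B : H →L[ℂ] H) : hsSq (A + B) ≤ 2 * hsSq A + 2 * hsSq B := by
  rw [hsSq, hsSq, hsSq, ← ENNReal.tsum_mul_left, ← ENNReal.tsum_mul_left, ← ENNReal.tsum_add]
  exact ENNReal.tsum_le_tsum fun i => enorm_add_sq_le _ _

theorem hsSq_sub_le (A B : H →L[ℂ] H) : hsSq (A - B) ≤ 2 * hsSq A + 2 * hsSq B := by
  simpa [sub_eq_add_neg, hsSq_neg] using hsSq_add_le A (-B)

theorem hsSq_mul_le_left (X A : H →L[ℂ] H) : hsSq (X * A) ≤ ‖X‖ₑ ^ 2 * hsSq A := by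
  rw [hsSq, hsSq, ← ENNReal.tsum_mul_left]
  refine ENNReal.tsum_le_tsum fun i => ?_
  rw [← mul_pow]
  gcongr
  exact X.le_opENorm _

theorem hsSq_mul_le_right (A X : H →L[ℂ] H) : hsSq (A * X) ≤ ‖X‖ₑ ^ 2 * hsSq A := by
  rw [← hsSq_adjoint (A * X), ← hsSq_adjoint A, ← ContinuousLinearMap.star_eq_adjoint, star_mul]
  refine (hsSq_mul_le_left _ _).trans_eq ?_
  rw [← ofReal_norm (star X), norm_star, ofReal_norm]
  rfl

/-- Passing to the adjoint avoids extending `e` to a Hilbert basis: expand the projection in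
`(VK*)bᵢ` along `e`, exchange the two sums, and apply Parseval to each `K (e i)`. -/
theorem hsSq_mul_starProjection_of_span_eq {ι : Type*} [Fintype ι] {e : ι → H}
    (he : Orthonormal ℂ e) {V : Submodule ℂ H} [V.HasOrthogonalProjection]
    (hV : Submodule.span ℂ (Set.range e) = V) (K : H →L[ℂ] H) :
    hsSq (K * V.starProjection) = ∑ i, ‖K (e i)‖ₑ ^ 2 := by
  have hP : ContinuousLinearMap.adjoint
      (K * V.starProjection) =
      V.starProjection * ContinuousLinearMap.adjoint K := by
    rw [← ContinuousLinearMap.star_eq_adjoint, star_mul,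
      (isSelfAdjoint_starProjection V).star_eq]
    rfl
  have key (y : H) : ‖V.starProjection y‖ₑ ^ 2
      = ∑ i, ‖⟪e i, y⟫_ℂ‖ₑ ^ 2 := by
    have : ‖V.starProjection y‖ ^ 2 = ∑ i, ‖⟪e i, y⟫_ℂ‖ ^ 2 := by
      rw [starProjection_apply_of_span_eq he hV, ← Complex.ofReal_inj, Complex.ofReal_pow]
      have := he.inner_sum (fun i => ⟪e i, y⟫_ℂ) (fun i => ⟪e i, y⟫_ℂ) Finset.univ
      rw [inner_self_eq_norm_sq_to_K] at this
      simp only [RCLike.conj_mul] at this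
      push_cast
      exact this
    simp only [← ofReal_norm, ← ENNReal.ofReal_pow (norm_nonneg _)]
    rw [this, ENNReal.ofReal_sum_of_nonneg fun i _ => by positivity]
  rw [← hsSq_adjoint, hP, hsSq]
  simp only [mul_apply_eq_comp, key]
  rw [Summable.tsum_finsetSum fun _ _ => ENNReal.summable]
  refine Finset.sum_congr rfl fun i _ => ?_
  simp only [ContinuousLinearMap.adjoint_inner_right]
  exact tsum_enorm_inner_sq _ _

theorem hsSq_mul_starProjection (V : Submodule ℂ H) [FiniteDimensional ℂ V] (K : H →L[ℂ] H) :
    hsSq (K * V.starProjection) =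
      ∑ i, ‖K (stdOrthonormalBasis ℂ V i : H)‖ₑ ^ 2 :=
  hsSq_mul_starProjection_of_span_eq (orthonormal_coe_stdOrthonormalBasis V)
    (span_range_stdOrthonormalBasis V) K

theorem hsSq_starProjection (V : Submodule ℂ H) [FiniteDimensional ℂ V] :
    hsSq V.starProjection = Module.finrank ℂ V := by
  have h := hsSq_mul_starProjection V 1
  rw [one_mul] at h
  rw [h]
  have (i : Fin (Module.finrank ℂ V)) : ‖(stdOrthonormalBasis ℂ V i : H)‖ₑ = 1 := by
    rw [← ofReal_norm, (orthonormal_coe_stdOrthonormalBasis V).norm_eq_one]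
    simp
  simp [this]

/-- The relative commutator size of `T` with the projection onto `V` is at most `ε`. -/
def IsFolnerSubspace (T : H →L[ℂ] H) (ε : ℝ) (V : Submodule ℂ H) : Prop :=
  ∃ _ : FiniteDimensional ℂ V, V ≠ ⊥ ∧
    hsSq (T * V.starProjection - V.starProjection * T) ≤
      ENNReal.ofReal (ε * Module.finrank ℂ V)

end HilbertSchmidt

end FiniteOperators

/-! ### Convexity of the numerical range, and the easy implication. -/

namespace FiniteOperators

variable {H : Type*} [NormedAddCommGroup H] [InnerProductSpace ℂ H]

/-- The Toeplitz-Hausdorff theorem in normalized form. -/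
theorem exists_unit_inner_eq_of_mem_Icc (B : H →L[ℂ] H) {x y : H} (hx : ‖x‖ = 1)
    (hy : ‖y‖ = 1) (hx0 : ⟪x, B x⟫_ℂ = 0) (hy1 : ⟪y, B y⟫_ℂ = 1) {t : ℝ} (ht : t ∈ Set.Icc (0 : ℝ) 1) :
    ∃ z : H, ‖z‖ = 1 ∧ ⟪z, B z⟫_ℂ = t := by
  -- Rescaling `y` by a suitable `c` makes the cross term real, so the quadratic form stays real
  -- along the segment from `x` to `c • y`. When the natural choice of `c` degenerates, the
  -- condition already holds with `c = 1`.
  obtain ⟨c, hc, him⟩ : ∃ c : ℂ, c ≠ 0 ∧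
      (c * ⟪x, B y⟫_ℂ + (starRingEnd ℂ) c * ⟪y, B x⟫_ℂ).im = 0 := by
    set p := ⟪x, B y⟫_ℂ
    set q := ⟪y, B x⟫_ℂ
    by_cases h : (⟨p.re - q.re, -(p.im + q.im)⟩ : ℂ) = 0
    · refine ⟨1, one_ne_zero, ?_⟩
      have := congrArg Complex.im h
      simp at this ⊢
      linarith
    · refine ⟨_, h, ?_⟩
      simp
      ring
  have hy0 : y ≠ 0 := by
    rintro rfl
    simp at hy1
  let z : ℝ → H := fun τ => ((1 - τ : ℝ) : ℂ) • x + ((τ : ℂ) * c) • y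
  have hz : Continuous z := by fun_prop
  have hz0 (τ : ℝ) : z τ ≠ 0 := by
    intro h
    by_cases h1 : τ = 1
    · simp [z, h1, hc, hy0] at h
    · have h2 : ((1 - τ : ℝ) : ℂ) ≠ 0 := by
        rw [Complex.ofReal_ne_zero]; exact sub_ne_zero.mpr (Ne.symm h1)
      -- The segment avoids zero: a non-zero multiple of `y` cannot have vanishing quadratic form,
      -- but `x` does.
      have h3 : x = (-(((1 - τ : ℝ) : ℂ)⁻¹ * ((τ : ℂ) * c))) • y := by
        have h4 := eq_neg_of_add_eq_zero_left h
        rw [neg_smul, mul_smul, ← smul_neg, ← h4, inv_smul_smul₀ h2]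
      have h5 := hx0
      rw [h3, map_smul, inner_smul_left, inner_smul_right, hy1, mul_one, mul_comm,
        mul_eq_zero] at h5
      have h6 : -(((1 - τ : ℝ) : ℂ)⁻¹ * ((τ : ℂ) * c)) = 0 := by
        rcases h5 with h5 | h5
        · exact h5
        · exact (map_eq_zero _).mp h5
      rw [h6, zero_smul] at h3
      simp [h3] at hx
  have hval (τ : ℝ) : ⟪z τ, B (z τ)⟫_ℂ = (τ * ‖c‖) ^ 2 + (1 - τ) * τ *
      (c * ⟪x, B y⟫_ℂ + (starRingEnd ℂ) c * ⟪y, B x⟫_ℂ) := by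
    simp only [z, map_add, map_smul, inner_add_left, inner_add_right, inner_smul_left,
      inner_smul_right, hx0, hy1, map_mul, Complex.conj_ofReal]
    have := Complex.mul_conj' c
    push_cast
    linear_combination (τ : ℂ) ^ 2 * this
  have hreal (τ : ℝ) : ⟪z τ, B (z τ)⟫_ℂ = ((⟪z τ, B (z τ)⟫_ℂ).re : ℂ) := by
    apply Complex.ext
    · simp
    · rw [Complex.ofReal_im, hval]
      have e1 : ((τ : ℂ) * ‖c‖) ^ 2 = (((τ * ‖c‖) ^ 2 : ℝ) : ℂ) := by push_cast; ring
      have e2 : (1 - (τ : ℂ)) * τ = (((1 - τ) * τ : ℝ) : ℂ) := by push_cast; ring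
      rw [e1, e2, Complex.add_im, Complex.ofReal_im, Complex.im_ofReal_mul, him]
      simp
  let f : ℝ → ℝ := fun τ => (⟪z τ, B (z τ)⟫_ℂ).re / ‖z τ‖ ^ 2
  have hf : Continuous f := by
    refine Continuous.div ?_ (by fun_prop) fun τ => by simpa using hz0 τ
    exact Complex.continuous_re.comp (by fun_prop)
  have hf0 : f 0 = 0 := by simp [f, hval]
  have hf1 : f 1 = 1 := by
    have h1 : ‖z 1‖ = ‖c‖ := by simp [z, norm_smul, hy]
    have h2 : (⟪z 1, B (z 1)⟫_ℂ).re = ‖c‖ ^ 2 := by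
      rw [hval]
      simp [← Complex.ofReal_pow]
    have h3 : ‖c‖ ≠ 0 := by simpa using hc
    simp only [f, h1, h2]
    field_simp
  obtain ⟨τ, -, hτ⟩ := intermediate_value_Icc zero_le_one hf.continuousOn (hf0 ▸ hf1 ▸ ht)
  refine ⟨((‖z τ‖ : ℂ)⁻¹) • z τ, ?_, ?_⟩
  · rw [norm_smul, norm_inv, Complex.norm_real, norm_norm, inv_mul_cancel₀]
    simpa using hz0 τ
  · rw [map_smul, inner_smul_left, inner_smul_right, hreal, ← hτ]
    simp only [f, map_inv₀, Complex.conj_ofReal]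
    push_cast
    ring

/-- An affine change of the operator sends the two chosen values to `0` and `1`. -/
theorem convex_numericalRange (A : H →L[ℂ] H) : Convex ℝ (numericalRange A) := by
  rintro _ ⟨x, hx, rfl⟩ _ ⟨y, hy, rfl⟩ s t hs ht hst
  set a := ⟪x, A x⟫_ℂ with ha
  set b := ⟪y, A y⟫_ℂ with hb
  by_cases hab : a = b
  · refine ⟨x, hx, ?_⟩
    rw [← hab, ← add_smul, hst, one_smul]
  have hba : b - a ≠ 0 := sub_ne_zero.mpr (Ne.symm hab)
  have hB (z : H) (hz : ‖z‖ = 1) :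
      ⟪z, ((b - a)⁻¹ • (A - a • (1 : H →L[ℂ] H))) z⟫_ℂ = (b - a)⁻¹ * (⟪z, A z⟫_ℂ - a) := by
    have : ⟪z, z⟫_ℂ = 1 := by rw [inner_self_eq_norm_sq_to_K, hz]; simp
    simp only [smul_apply, sub_apply, one_apply_eq_self, inner_smul_right, inner_sub_right, this]
    simp
  obtain ⟨z, hz, hzt⟩ := exists_unit_inner_eq_of_mem_Icc ((b - a)⁻¹ • (A - a • (1 : H →L[ℂ] H)))
    hx hy (by rw [hB x hx, ← ha]; simp)
    (by rw [hB y hy, ← hb, inv_mul_cancel₀ hba]) ⟨ht, by linarith⟩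
  refine ⟨z, hz, ?_⟩
  rw [hB z hz, inv_mul_eq_iff_eq_mul₀ hba] at hzt
  have : (s : ℂ) = 1 - t := by
    rw [eq_sub_iff_add_eq]
    exact_mod_cast hst
  rw [Complex.real_smul, Complex.real_smul, this]
  linear_combination hzt

variable [CompleteSpace H]

theorem sum_norm_sq_le_of_hsSq_le {ι : Type*} [Fintype ι] {e : ι → H} (he : Orthonormal ℂ e)
    {K : H →L[ℂ] H} {c : ℝ} (hc : 0 ≤ c) (hK : hsSq K ≤ ENNReal.ofReal c) :
    ∑ i, ‖K (e i)‖ ^ 2 ≤ c := by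
  have : FiniteDimensional ℂ (Submodule.span ℂ (Set.range e)) :=
    FiniteDimensional.span_of_finite ℂ (Set.finite_range e)
  have h := hsSq_mul_starProjection_of_span_eq he rfl K
  have h2 : hsSq (K * (Submodule.span ℂ (Set.range e)).starProjection) ≤ ENNReal.ofReal c := by
    refine (hsSq_mul_le_right _ _).trans (le_trans ?_ hK)
    refine mul_le_of_le_one_left' (pow_le_one₀ zero_le ?_)
    rw [← ofReal_norm, ENNReal.ofReal_le_one]
    exact Submodule.starProjection_norm_le _
  rw [h] at h2
  simp only [← ofReal_norm, ← ENNReal.ofReal_pow (norm_nonneg _)] at h2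
  rwa [← ENNReal.ofReal_sum_of_nonneg fun i _ => by positivity, ENNReal.ofReal_le_ofReal_iff hc]
    at h2

theorem sum_norm_le_of_hsSq_le {ι : Type*} [Fintype ι] {e : ι → H} (he : Orthonormal ℂ e)
    {K : H →L[ℂ] H} {η : ℝ} (hη : 0 ≤ η)
    (hK : hsSq K ≤ ENNReal.ofReal (η ^ 2 * Fintype.card ι)) :
    ∑ i, ‖K (e i)‖ ≤ η * Fintype.card ι := by
  have h1 := sum_norm_sq_le_of_hsSq_le he (by positivity) hK
  have h2 := sq_sum_le_card_mul_sum_sq (s := Finset.univ) (f := fun i => ‖K (e i)‖)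
  refine le_of_sq_le_sq ?_ (by positivity)
  refine h2.trans ?_
  rw [Finset.card_univ]
  nlinarith [Nat.cast_nonneg (α := ℝ) (Fintype.card ι)]

/-- With `K = TP - PT`, inserting `P` between the factors of `TX` and `XT` costs only terms in `K* e
i` and `K (e i)`. The remaining terms are the traces of `PTPXP` and `PXPTP`, which agree.
Cauchy-Schwarz turns the Hilbert-Schmidt bound into an `ℓ¹` bound on each error. -/
theorem norm_sum_inner_commutator_le {ι : Type*} [Fintype ι] {e : ι → H} (he : Orthonormal ℂ e)
    {V : Submodule ℂ H} [V.HasOrthogonalProjection]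
    (hV : Submodule.span ℂ (Set.range e) = V) (T X : H →L[ℂ] H) {η : ℝ} (hη : 0 ≤ η)
    (hK : hsSq (T * V.starProjection - V.starProjection * T) ≤
      ENNReal.ofReal (η ^ 2 * Fintype.card ι)) :
    ‖∑ i, ⟪e i, (T * X - X * T) (e i)⟫_ℂ‖ ≤ 2 * ‖X‖ * (η * Fintype.card ι) := by
  set P := V.starProjection with hP
  set K := T * P - P * T with hKdef
  have hPe (i) : P (e i) = e i :=
    Submodule.starProjection_eq_self_iff.mpr (hV ▸ Submodule.subset_span ⟨i, rfl⟩)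
  have hsum (x : H) : P x = ∑ i, ⟪e i, x⟫_ℂ • e i := starProjection_apply_of_span_eq he hV x
  have hsymm (x y : H) : ⟪P x, y⟫_ℂ = ⟪x, P y⟫_ℂ := V.inner_starProjection_left_eq_right x y
  have hKe (i) : K (e i) = T (e i) - P (T (e i)) := by
    simp [hKdef, hPe]
  have hKe' (i) (y : H) : ⟪ContinuousLinearMap.adjoint K (e i), y⟫_ℂ =
      ⟪e i, T (P y)⟫_ℂ - ⟪e i, T y⟫_ℂ := by
    rw [ContinuousLinearMap.adjoint_inner_left, hKdef]
    simp only [sub_apply, mul_apply_eq_comp, inner_sub_right]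
    rw [← hsymm (e i), hPe]
  have hswap : ∑ i, ⟪e i, T (P (X (e i)))⟫_ℂ = ∑ i, ⟪e i, X (P (T (e i)))⟫_ℂ := by
    simp only [hsum, map_sum, map_smul, inner_sum, inner_smul_right]
    rw [Finset.sum_comm]
    refine Finset.sum_congr rfl fun i _ => Finset.sum_congr rfl fun j _ => mul_comm _ _
  have hterm (i) : ⟪e i, (T * X - X * T) (e i)⟫_ℂ =
      (⟪e i, T (P (X (e i)))⟫_ℂ - ⟪e i, X (P (T (e i)))⟫_ℂ) -
      (⟪ContinuousLinearMap.adjoint K (e i), X (e i)⟫_ℂ + ⟪e i, X (K (e i))⟫_ℂ) := by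
    rw [hKe', hKe]
    simp only [sub_apply, mul_apply_eq_comp, inner_sub_right, map_sub]
    ring
  have hX (i) (y : H) : ‖⟪e i, X y⟫_ℂ‖ ≤ ‖X‖ * ‖y‖ := by
    refine (norm_inner_le_norm _ _).trans ?_
    rw [he.norm_eq_one, one_mul]
    exact X.le_opNorm y
  have hX' (i) (y : H) : ‖⟪y, X (e i)⟫_ℂ‖ ≤ ‖X‖ * ‖y‖ := by
    refine (norm_inner_le_norm _ _).trans ?_
    rw [mul_comm]
    gcongr
    simpa [he.norm_eq_one] using X.le_opNorm (e i)
  rw [Finset.sum_congr rfl fun i _ => hterm i, Finset.sum_sub_distrib, Finset.sum_sub_distrib,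
    hswap, sub_self, zero_sub, norm_neg]
  calc _ ≤ ∑ i, (‖X‖ * ‖ContinuousLinearMap.adjoint K (e i)‖ + ‖X‖ * ‖K (e i)‖) :=
        (norm_sum_le _ _).trans <| Finset.sum_le_sum fun i _ =>
          (norm_add_le _ _).trans <| add_le_add (hX' i _) (hX i _)
    _ = ‖X‖ * (∑ i, ‖ContinuousLinearMap.adjoint K (e i)‖ + ∑ i, ‖K (e i)‖) := by
        rw [Finset.sum_add_distrib, ← Finset.mul_sum, ← Finset.mul_sum, mul_add]
    _ ≤ ‖X‖ * (η * Fintype.card ι + η * Fintype.card ι) := by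
        gcongr
        · exact sum_norm_le_of_hsSq_le he hη (by rwa [hsSq_adjoint])
        · exact sum_norm_le_of_hsSq_le he hη hK
    _ = _ := by ring

theorem isFiniteOperator_of_isFolnerSubspace {T : H →L[ℂ] H}
    (h : ∀ ε : ℝ, 0 < ε → ∃ V, IsFolnerSubspace T ε V) : IsFiniteOperator T := by
  intro X
  rw [Metric.mem_closure_iff]
  intro ε hε
  obtain ⟨η, hη, hηε⟩ : ∃ η : ℝ, 0 < η ∧ 2 * ‖X‖ * η < ε := by
    refine ⟨ε / (2 * ‖X‖ + 1), by positivity, ?_⟩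
    rw [mul_div_assoc', div_lt_iff₀ (by positivity)]
    linarith
  obtain ⟨V, hfin, hV0, hV⟩ := h (η ^ 2) (by positivity)
  set N := Module.finrank ℂ V with hN
  have hNpos : 0 < N := by
    rw [hN, Module.finrank_pos_iff]
    exact Submodule.nontrivial_iff_ne_bot.mpr hV0
  let e : Fin N → H := fun i => (stdOrthonormalBasis ℂ V i : H)
  have he : Orthonormal ℂ e := orthonormal_coe_stdOrthonormalBasis V
  have hb := norm_sum_inner_commutator_le he (span_range_stdOrthonormalBasis V) T X hη.le
    (by simpa using hV)
  -- The average of the quadratic form over an orthonormal basis of `V` is a convex combination of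
  -- numerical range values.
  refine ⟨∑ i, (1 / N : ℝ) • ⟪e i, (T * X - X * T) (e i)⟫_ℂ, ?_, ?_⟩
  · refine (convex_numericalRange _).sum_mem (fun _ _ => by positivity) ?_ ?_
    · simp [hNpos.ne']
    · exact fun i _ => ⟨e i, he.norm_eq_one i, rfl⟩
  · rw [dist_zero_left, ← Finset.smul_sum, norm_smul]
    refine lt_of_le_of_lt (mul_le_mul_of_nonneg_left hb (norm_nonneg _)) ?_
    have : (N : ℝ) ≠ 0 := by exact_mod_cast hNpos.ne'
    rw [Fintype.card_fin, Real.norm_of_nonneg (by positivity)]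
    calc _ = 2 * ‖X‖ * η := by field_simp
      _ < ε := hηε

theorem IsFiniteBlockReducible.isFolnerSubspace {T : H →L[ℂ] H} (h : IsFiniteBlockReducible T)
    (ε : ℝ) : ∃ V, IsFolnerSubspace T ε V := by
  obtain ⟨V, hV0, hfin, h1, h2⟩ := h
  refine ⟨V, hfin, hV0, ?_⟩
  have : T * V.starProjection - V.starProjection * T = 0 := by
    ext x
    have hx : T x = T (V.starProjection x) + T (x - V.starProjection x) := by
      rw [← map_add]; simp
    have e1 := Submodule.starProjection_eq_self_iff.mpr (h1 _ (V.starProjection_apply_mem x))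
    have e2 := V.starProjection_apply_eq_zero_iff.mpr
      (h2 _ (Submodule.sub_starProjection_mem_orthogonal x))
    simp only [sub_apply, mul_apply_eq_comp, zero_apply]
    rw [hx, map_add, e1, e2, add_zero, sub_self]
  rw [this]
  simp [hsSq]

theorem hsNorm_starProjection (V : Submodule ℂ H) [FiniteDimensional ℂ V] :
    hsNorm V.starProjection = (Module.finrank ℂ V : ℝ≥0∞) ^ (1 / 2 : ℝ) := by
  rw [hsNorm_eq_rpow, hsSq_starProjection]

theorem HasProperFolnerSequence.isFolnerSubspace {T : H →L[ℂ] H} (h : HasProperFolnerSequence T)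
    {ε : ℝ} (hε : 0 < ε) : ∃ V, IsFolnerSubspace T ε V := by
  obtain ⟨P, ⟨hP, hlim⟩, -⟩ := h
  have hlim := hlim T rfl
  have hev := hlim.eventually_lt_const (u := ENNReal.ofReal (√ε)) (by simpa using hε)
  obtain ⟨n, hn⟩ := hev.exists
  obtain ⟨hne, hproj, hfin⟩ := hP n
  obtain ⟨V, hVeq⟩ : ∃ V : Submodule ℂ H, V = LinearMap.range (P n : H →ₗ[ℂ] H) := ⟨_, rfl⟩
  have : FiniteDimensional ℂ V := hVeq ▸ hfin
  obtain ⟨_, hPV⟩ := isStarProjection_iff_eq_starProjection_range.mp hproj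
  have hPV : P n = V.starProjection := by
    subst hVeq
    exact hPV
  refine ⟨V, this, ?_, ?_⟩
  · rintro rfl
    exact hne (by rw [hPV, Submodule.starProjection_bot])
  have hsq (a : ℝ≥0∞) : (a ^ (1 / 2 : ℝ)) ^ 2 = a := by
    rw [← ENNReal.rpow_natCast, ← ENNReal.rpow_mul]
    norm_num
  have hV0 : (Module.finrank ℂ V : ℝ≥0∞) ≠ 0 := by
    rw [Nat.cast_ne_zero, ← Nat.pos_iff_ne_zero, Module.finrank_pos_iff,
      Submodule.nontrivial_iff_ne_bot]
    rintro rfl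
    exact hne (by rw [hPV, Submodule.starProjection_bot])
  rw [hPV, hsNorm_starProjection, hsNorm_eq_rpow] at hn
  have hn' := (ENNReal.div_le_iff (by simpa using hV0) (by simp)).mp hn.le
  rw [← hsq (hsSq _), ENNReal.ofReal_mul hε.le, ENNReal.ofReal_natCast,
    ← hsq (Module.finrank ℂ V : ℝ≥0∞), ← Real.sq_sqrt hε.le,
    ENNReal.ofReal_pow (Real.sqrt_nonneg _), ← mul_pow]
  exact pow_le_pow_left₀ zero_le hn' 2

end FiniteOperators

/-! ### Hypertraces and finite block reducibility. -/

namespace FiniteOperators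

variable {H : Type*} [NormedAddCommGroup H] [InnerProductSpace ℂ H]

/-- `Z` is strictly accretive: the real part of its numerical range is bounded below by a positive
constant. -/
def IsStrictlyAccretive (Z : H →L[ℂ] H) : Prop :=
  ∃ δ : ℝ, 0 < δ ∧ ∀ x : H, δ * ‖x‖ ^ 2 ≤ (⟪x, Z x⟫_ℂ).re

theorem isOpen_isStrictlyAccretive : IsOpen {Z : H →L[ℂ] H | IsStrictlyAccretive Z} := by
  rw [Metric.isOpen_iff]
  rintro Z ⟨δ, hδ, hZ⟩
  refine ⟨δ / 2, by positivity, fun Z' hZ' => ⟨δ / 2, by positivity, fun x => ?_⟩⟩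
  have h1 : ‖(⟪x, (Z' - Z) x⟫_ℂ)‖ ≤ δ / 2 * ‖x‖ ^ 2 := by
    refine (norm_inner_le_norm _ _).trans ?_
    have h2 := (Z' - Z).le_opNorm x
    rw [Metric.mem_ball, dist_eq_norm] at hZ'
    nlinarith [norm_nonneg x, mul_nonneg (norm_nonneg x) (norm_nonneg x)]
  have h3 := neg_le_of_abs_le ((Complex.abs_re_le_norm _).trans h1)
  rw [sub_apply, inner_sub_right, Complex.sub_re] at h3
  linarith [hZ x]

theorem convex_isStrictlyAccretive : Convex ℝ {Z : H →L[ℂ] H | IsStrictlyAccretive Z} := by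
  rw [convex_iff_forall_pos]
  rintro Z ⟨δ, hδ, hZ⟩ Z' ⟨δ', hδ', hZ'⟩ s t hs ht -
  refine ⟨s * δ + t * δ', by positivity, fun x => ?_⟩
  have h : (⟪x, (s • Z + t • Z') x⟫_ℂ).re = s * (⟪x, Z x⟫_ℂ).re + t * (⟪x, Z' x⟫_ℂ).re := by
    simp only [add_apply, smul_apply, inner_add_right, Complex.add_re]
    rw [← Complex.coe_smul, ← Complex.coe_smul, inner_smul_right, inner_smul_right,
      Complex.re_ofReal_mul, Complex.re_ofReal_mul]
  rw [h]
  nlinarith [hZ x, hZ' x]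

theorem IsFiniteOperator.not_isStrictlyAccretive {T : H →L[ℂ] H} (hT : IsFiniteOperator T)
    (X : H →L[ℂ] H) : ¬ IsStrictlyAccretive (T * X - X * T) := by
  rintro ⟨δ, hδ, h⟩
  obtain ⟨_, ⟨x, hx, rfl⟩, hlt⟩ := Metric.mem_closure_iff.mp (hT X) δ hδ
  rw [dist_zero_left] at hlt
  have h1 := h x
  rw [hx] at h1
  have h2 := (Complex.re_le_norm _).trans_lt hlt
  linarith

theorem eq_zero_of_forall_le_re_smul {u : ℝ} {w : ℂ} (h : ∀ c : ℂ, u ≤ (c * w).re) : w = 0 := by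
  by_contra hw
  have := h (((u - 1 : ℝ) : ℂ) * w⁻¹)
  rw [inv_mul_cancel_right₀ hw, Complex.ofReal_re] at this
  linarith

/-- A finite operator has a hypertrace. -/
theorem IsFiniteOperator.exists_hypertrace {T : H →L[ℂ] H} (hT : IsFiniteOperator T) :
    ∃ f : StrongDual ℂ (H →L[ℂ] H), (∀ X, f (T * X - X * T) = 0) ∧
      ∀ Z, IsStrictlyAccretive Z → 0 < (f Z).re := by
  let M : Submodule ℝ (H →L[ℂ] H) :=
    LinearMap.range ((LinearMap.mulLeft ℝ T) - LinearMap.mulRight ℝ T)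
  -- Strictly accretive operators form a norm-open convex set disjoint from the subspace of
  -- commutators. The separating functional is bounded below on that subspace, hence vanishes there,
  -- and its negative is the hypertrace.
  obtain ⟨f, u, hf, hfM⟩ := RCLike.geometric_hahn_banach_open (𝕜 := ℂ)
    (convex_isStrictlyAccretive (H := H)) isOpen_isStrictlyAccretive M.convex (by
      rw [Set.disjoint_left]
      rintro Z hZ ⟨X, rfl⟩
      exact hT.not_isStrictlyAccretive X hZ)
  have h0 (X) : f (T * X - X * T) = 0 := by
    refine eq_zero_of_forall_le_re_smul (u := u) fun c => ?_
    have := hfM (T * (c • X) - (c • X) * T) ⟨c • X, rfl⟩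
    rwa [mul_smul_comm, smul_mul_assoc, ← smul_sub, map_smul] at this
  refine ⟨-f, fun X => by rw [neg_apply, h0, neg_zero], fun Z hZ => ?_⟩
  have h1 := hf Z hZ
  have h2 := hfM _ M.zero_mem
  simp at h1 h2 ⊢
  linarith

theorem re_apply_nonneg_of_accretive {f : StrongDual ℂ (H →L[ℂ] H)}
    (hf : ∀ Z, IsStrictlyAccretive Z → 0 < (f Z).re) {Z : H →L[ℂ] H}
    (hZ : ∀ x, 0 ≤ (⟪x, Z x⟫_ℂ).re) : 0 ≤ (f Z).re := by
  have h (n : ℕ) : 0 ≤ (f Z).re + (1 / ((n : ℝ) + 1)) * (f 1).re := by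
    have := hf (Z + ((1 / ((n : ℝ) + 1) : ℝ) : ℂ) • 1) ⟨1 / ((n : ℝ) + 1), by positivity, fun x => ?_⟩
    · rw [map_add, map_smul, smul_eq_mul, Complex.add_re, Complex.re_ofReal_mul] at this
      exact this.le
    · rw [add_apply, inner_add_right, smul_apply, inner_smul_right, Complex.add_re,
        Complex.re_ofReal_mul, one_apply_eq_self]
      have : (⟪x, x⟫_ℂ).re = ‖x‖ ^ 2 := inner_self_eq_norm_sq (𝕜 := ℂ) x
      rw [this]
      linarith [hZ x]
  have hlim : Tendsto (fun n : ℕ => (f Z).re + (1 / ((n : ℝ) + 1)) * (f 1).re) atTop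
      (𝓝 ((f Z).re + 0 * (f 1).re)) :=
    tendsto_const_nhds.add (tendsto_one_div_add_atTop_nhds_zero_nat.mul tendsto_const_nhds)
  rw [zero_mul, add_zero] at hlim
  exact ge_of_tendsto' hlim h

/-- Any multiple `c` of a positive rank one operator with `0 ≤ c.re` is accretive; the choices `1`,
`I`, `-I` locate the value on the non-negative real axis. -/
theorem apply_rankOne_self_nonneg {f : StrongDual ℂ (H →L[ℂ] H)}
    (hf : ∀ Z, IsStrictlyAccretive Z → 0 < (f Z).re) (x : H) :
    0 ≤ (f (InnerProductSpace.rankOne ℂ x x)).re ∧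
      (f (InnerProductSpace.rankOne ℂ x x)).im = 0 := by
  have key (c : ℂ) (hc : 0 ≤ c.re) : 0 ≤ (c * f (InnerProductSpace.rankOne ℂ x x)).re := by
    rw [← smul_eq_mul, ← map_smul]
    refine re_apply_nonneg_of_accretive hf fun y => ?_
    rw [smul_apply, inner_smul_right, InnerProductSpace.rankOne_apply, inner_smul_right,
      ← inner_conj_symm y, Complex.mul_conj, Complex.re_mul_ofReal]
    exact mul_nonneg hc (Complex.normSq_nonneg _)
  have h1 := key 1 (by simp)
  have h2 := key Complex.I (by simp)
  have h3 := key (-Complex.I) (by simp)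
  simp at h1 h2 h3
  exact ⟨h1, by linarith⟩

/-- Bessel's inequality makes `1 - ∑ eᵢ ⊗ eᵢ` positive. This is the trace bound for the operator
representing `f` on rank one operators. -/
theorem re_sum_apply_rankOne_self_le {f : StrongDual ℂ (H →L[ℂ] H)}
    (hf : ∀ Z, IsStrictlyAccretive Z → 0 < (f Z).re) {ι : Type*} [Fintype ι] {e : ι → H}
    (he : Orthonormal ℂ e) :
    ∑ i, (f (InnerProductSpace.rankOne ℂ (e i) (e i))).re ≤ (f 1).re := by
  have := re_apply_nonneg_of_accretive hf
    (Z := 1 - ∑ i, InnerProductSpace.rankOne ℂ (e i) (e i)) fun x => ?_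
  · rw [map_sub, map_sum, Complex.sub_re, Complex.re_sum] at this
    linarith
  · have h1 := he.sum_inner_products_le x (s := Finset.univ)
    have h2 : (⟪x, x⟫_ℂ).re = ‖x‖ ^ 2 := inner_self_eq_norm_sq (𝕜 := ℂ) x
    have h3 (i) : (⟪x, InnerProductSpace.rankOne ℂ (e i) (e i) x⟫_ℂ).re = ‖⟪e i, x⟫_ℂ‖ ^ 2 := by
      rw [InnerProductSpace.rankOne_apply, inner_smul_right, ← inner_conj_symm x,
        Complex.mul_conj, Complex.normSq_eq_norm_sq, Complex.ofReal_re]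
    rw [sub_apply, inner_sub_right, Complex.sub_re, sum_apply, inner_sum, Complex.re_sum,
      one_apply_eq_self, h2, Finset.sum_congr rfl fun i _ => h3 i]
    linarith

theorem finiteDimensional_of_finrank_le {W : Submodule ℂ H} (n : ℕ)
    (h : ∀ V : Submodule ℂ H, V ≤ W → FiniteDimensional ℂ V → Module.finrank ℂ V ≤ n) :
    FiniteDimensional ℂ W := by
  by_contra hW
  have h1 : ((n + 1 : ℕ) : Cardinal) ≤ Module.rank ℂ W := by
    have : Cardinal.aleph0 ≤ Module.rank ℂ W := by
      rw [← not_lt]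
      exact fun h => hW (Module.rank_lt_aleph0_iff.mp h)
    exact Cardinal.natCast_le_aleph0.trans this
  obtain ⟨v, hv⟩ := Module.le_rank_iff.mp h1
  have hv' : LinearIndependent ℂ fun i => (v i : H) := hv.map' W.subtype W.ker_subtype
  have h2 := h (Submodule.span ℂ (Set.range fun i => (v i : H)))
    (Submodule.span_le.mpr (by rintro _ ⟨i, rfl⟩; exact (v i).2))
    (FiniteDimensional.span_of_finite ℂ (Set.finite_range _))
  rw [finrank_span_eq_card hv', Fintype.card_fin] at h2
  omega

variable [CompleteSpace H]

theorem exists_clm_inner_eq (B : H → H → ℂ) (hadd_left : ∀ y y' x, B (y + y') x = B y x + B y' x)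
    (hsmul_left : ∀ (c : ℂ) y x, B (c • y) x = (starRingEnd ℂ) c * B y x)
    (hadd_right : ∀ y x x', B y (x + x') = B y x + B y x')
    (hsmul_right : ∀ (c : ℂ) y x, B y (c • x) = c * B y x)
    (C : ℝ) (hC : ∀ y x, ‖B y x‖ ≤ C * ‖y‖ * ‖x‖) :
    ∃ Y : H →L[ℂ] H, ∀ y x, ⟪y, Y x⟫_ℂ = B y x := by
  let L : H →L⋆[ℂ] H →L[ℂ] ℂ :=
    (LinearMap.mk₂'ₛₗ (starRingEnd ℂ) (RingHom.id ℂ) B hadd_left hsmul_left hadd_right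
      hsmul_right).mkContinuous₂ C hC
  refine ⟨ContinuousLinearMap.adjoint (InnerProductSpace.continuousLinearMapOfBilin L),
    fun y x => ?_⟩
  rw [ContinuousLinearMap.adjoint_inner_right,
    InnerProductSpace.continuousLinearMapOfBilin_apply]
  rfl

open ContinuousLinearMap in
/-- An operator commuting with a non-zero positive trace class operator is finite block
reducible. -/
theorem isFiniteBlockReducible_of_commute {T R : H →L[ℂ] H} (hR : R.IsPositive) (hR0 : R ≠ 0)
    (hcomm : Commute R T) (c : ℝ)
    (hc : ∀ (n : ℕ) (e : Fin n → H), Orthonormal ℂ e → ∑ i, (⟪e i, R (e i)⟫_ℂ).re ≤ c) :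
    IsFiniteBlockReducible T := by
  obtain ⟨x, hx⟩ : ∃ x, 0 < (⟪x, R x⟫_ℂ).re := by
    by_contra! h
    refine hR0 (ContinuousLinearMap.coe_injective ?_)
    refine (inner_map_self_eq_zero (R : H →ₗ[ℂ] H)).mp fun x => ?_
    have h1 := (isPositive_iff_complex R).mp hR x
    have h2 := h x
    rw [← inner_conj_symm, Complex.conj_re] at h2
    have h3 : RCLike.re ⟪R x, x⟫_ℂ = 0 := le_antisymm h2 h1.2
    have h4 := h1.1
    rw [h3] at h4
    simpa using h4.symm
  have hx0 : 0 < ‖x‖ ^ 2 := by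
    have : x ≠ 0 := by rintro rfl; simp at hx
    positivity
  -- Half the Rayleigh quotient at `x`, so that `R - ε` is positive at `x` and its positive part is
  -- non-zero. The range of this positive part will be the reducing subspace.
  set ε : ℝ := (⟪x, R x⟫_ℂ).re / ‖x‖ ^ 2 / 2 with hε
  have hεpos : 0 < ε := by positivity
  set A : H →L[ℂ] H := R - (ε : ℂ) • 1 with hA
  have hAsa : IsSelfAdjoint A := hR.isSelfAdjoint.sub
    (IsSelfAdjoint.smul (by simp [isSelfAdjoint_iff]) (.one _))
  have hAT : Commute A T := hcomm.sub_left ((Commute.one_left T).smul_left _)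
  have hBT : Commute A⁺ T := hAT.cfcₙ_real _
  have hBsa : IsSelfAdjoint A⁺ := (CFC.posPart_nonneg A).isSelfAdjoint
  have hBA : A * A⁺ = A⁺ * A⁺ := by
    calc A * A⁺ = (A⁺ - A⁻) * A⁺ := by rw [CFC.posPart_sub_negPart A hAsa]
      _ = A⁺ * A⁺ := by rw [sub_mul, CFC.negPart_mul_posPart, sub_zero]
  have hBeq : ∃ B : H →L[ℂ] H, B = A⁺ := ⟨_, rfl⟩
  obtain ⟨B, hB⟩ := hBeq
  have hBpos : B.IsPositive := by
    rw [← ContinuousLinearMap.nonneg_iff_isPositive, hB]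
    exact CFC.posPart_nonneg A
  rw [← hB] at hBT hBsa hBA
  have hker (y : H) : y ∈ (LinearMap.range (B : H →ₗ[ℂ] H))ᗮ ↔ B y = 0 := by
    rw [B.orthogonal_range, hBsa.adjoint_eq, LinearMap.mem_ker]
    rfl
  refine ⟨LinearMap.range (B : H →ₗ[ℂ] H), ?_, ?_, ?_, ?_⟩
  · intro h
    have hB0 : B = 0 := by
      ext y
      have : B y ∈ LinearMap.range (B : H →ₗ[ℂ] H) := ⟨y, rfl⟩
      rw [h] at this
      simpa using this
    have h1 : A ≤ 0 := by
      rw [← CFC.posPart_eq_zero_iff A hAsa]; rw [← hB]; exact hB0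
    rw [ContinuousLinearMap.le_def] at h1
    have h2 := h1.re_inner_nonneg_right x
    have h3 : (⟪x, x⟫_ℂ).re = ‖x‖ ^ 2 := inner_self_eq_norm_sq (𝕜 := ℂ) x
    have h4 : (⟪x, (0 - A) x⟫_ℂ).re = ε * ‖x‖ ^ 2 - (⟪x, R x⟫_ℂ).re := by
      rw [hA, zero_sub, neg_sub, sub_apply, smul_apply, one_apply_eq_self, inner_sub_right,
        inner_smul_right, Complex.sub_re, Complex.re_ofReal_mul, h3]
    have h5 : ε * ‖x‖ ^ 2 = (⟪x, R x⟫_ℂ).re / 2 := by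
      rw [hε, div_right_comm, div_mul_cancel₀ _ hx0.ne']
    have h6 : 0 ≤ (⟪x, (0 - A) x⟫_ℂ).re := h2
    linarith
  -- On the range of `B` one has `RB = B² + εB`, so `R` is bounded below by `ε` there, and the trace
  -- bound `c` allows dimension at most `c / ε`.
  · refine finiteDimensional_of_finrank_le ⌊c / ε⌋₊ fun V hV hfin => ?_
    refine Nat.le_floor ?_
    rw [le_div_iff₀ hεpos]
    refine le_trans ?_ (hc _ _ (orthonormal_coe_stdOrthonormalBasis V))
    rw [← nsmul_eq_mul]
    conv_lhs => rw [← Fintype.card_fin (Module.finrank ℂ V), ← Finset.card_univ]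
    refine Finset.card_nsmul_le_sum _ _ _ fun i _ => ?_
    obtain ⟨y, hy⟩ := hV (stdOrthonormalBasis ℂ V i).2
    have h1 := (orthonormal_coe_stdOrthonormalBasis V).norm_eq_one i
    have h2 : (⟪B y, B y⟫_ℂ).re = ‖B y‖ ^ 2 := inner_self_eq_norm_sq (𝕜 := ℂ) _
    have hy' : (stdOrthonormalBasis ℂ V i : H) = B y := hy.symm
    rw [hy'] at h1 ⊢
    have h3 : R (B y) = B (B y) + (ε : ℂ) • B y := by
      have := congrArg (· y) hBA
      simp only [hA, mul_apply_eq_comp, sub_apply, smul_apply, one_apply_eq_self] at this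
      rw [← this, sub_add_cancel]
    have h4 : 0 ≤ (⟪B y, B (B y)⟫_ℂ).re := hBpos.re_inner_nonneg_right (B y)
    rw [h3, inner_add_right, inner_smul_right, Complex.add_re, Complex.re_ofReal_mul, h2, h1]
    linarith
  · rintro _ ⟨y, rfl⟩
    exact ⟨T y, congrArg (· y) hBT.eq⟩
  · intro y hy
    rw [hker] at hy ⊢
    have := congrArg (· y) hBT.eq
    simpa [hy] using this

/-- The form `(y, x) ↦ f (x ⊗ y)` is represented by a positive operator `R` with bounded trace.
Since `T(x ⊗ y) = Tx ⊗ y` and `(x ⊗ y)T = x ⊗ T*y`, the trace property of `f` says exactly that `R`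
commutes with `T`. -/
theorem isFiniteBlockReducible_of_hypertrace {T : H →L[ℂ] H} {f : StrongDual ℂ (H →L[ℂ] H)}
    (hfT : ∀ X, f (T * X - X * T) = 0) (hf : ∀ Z, IsStrictlyAccretive Z → 0 < (f Z).re)
    {x y : H} (hxy : f (InnerProductSpace.rankOne ℂ x y) ≠ 0) : IsFiniteBlockReducible T := by
  obtain ⟨R, hR⟩ := exists_clm_inner_eq (fun y x => f (InnerProductSpace.rankOne ℂ x y))
    (by simp) (by simp) (by simp) (by simp) ‖f‖ (fun y x => by
      refine (f.le_opNorm _).trans ?_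
      rw [InnerProductSpace.norm_rankOne, mul_comm ‖x‖, mul_assoc])
  refine isFiniteBlockReducible_of_commute (R := R) ?_ ?_ ?_ (f 1).re fun n e he => ?_
  · rw [ContinuousLinearMap.isPositive_iff_complex]
    intro x
    have h1 := apply_rankOne_self_nonneg hf x
    have h2 : ⟪R x, x⟫_ℂ = f (InnerProductSpace.rankOne ℂ x x) := by
      rw [← inner_conj_symm, hR]
      exact Complex.conj_eq_iff_im.mpr h1.2
    rw [h2]
    exact ⟨Complex.ext (by simp) (by simp [h1.2]), h1.1⟩
  · rintro rfl
    exact hxy (by simpa using (hR y x).symm)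
  · ext x
    refine ext_inner_left ℂ fun y => ?_
    rw [mul_apply_eq_comp, mul_apply_eq_comp, hR, ← ContinuousLinearMap.adjoint_inner_left, hR,
      ← sub_eq_zero, ← map_sub, ← hfT (InnerProductSpace.rankOne ℂ x y)]
    congr 1
    ext z
    simp [ContinuousLinearMap.adjoint_inner_left]
  · simpa only [hR] using re_sum_apply_rankOne_self_le hf he

/-- Without block reducibility the hypertrace kills finite-rank operators. If the commutator were
bounded below by `δ` on `Fᗮ`, compressing it to `Fᗮ` and adding `δ` on `F` would give a strictly
accretive operator of hypertrace zero. -/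
theorem IsFiniteOperator.exists_unit_orthogonal_re_inner_lt {T : H →L[ℂ] H}
    (hT : IsFiniteOperator T) (hred : ¬ IsFiniteBlockReducible T) (F : Submodule ℂ H)
    [FiniteDimensional ℂ F] (Y : H →L[ℂ] H) {δ : ℝ} (hδ : 0 < δ) :
    ∃ x ∈ Fᗮ, ‖x‖ = 1 ∧ (⟪x, (Y * T - T * Y) x⟫_ℂ).re < δ := by
  obtain ⟨f, hfT, hf⟩ := hT.exists_hypertrace
  have hrank (x y : H) : f (InnerProductSpace.rankOne ℂ x y) = 0 := by
    by_contra h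
    exact hred (isFiniteBlockReducible_of_hypertrace hfT hf h)
  by_contra! hcon
  set C := Y * T - T * Y with hC
  have hC' (x : H) (hx : x ∈ Fᗮ) : δ * ‖x‖ ^ 2 ≤ (⟪x, C x⟫_ℂ).re := by
    by_cases hx0 : x = 0
    · simp [hx0]
    have hn : ‖x‖ ≠ 0 := norm_ne_zero_iff.mpr hx0
    have h1 := hcon (((‖x‖⁻¹ : ℝ) : ℂ) • x) (Submodule.smul_mem _ _ hx)
      (by rw [norm_smul, Complex.norm_real, norm_inv, norm_norm, inv_mul_cancel₀ hn])
    rw [map_smul, inner_smul_left, inner_smul_right, Complex.conj_ofReal, Complex.re_ofReal_mul,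
      Complex.re_ofReal_mul, ← mul_assoc] at h1
    have h2 := mul_le_mul_of_nonneg_right h1 (sq_nonneg ‖x‖)
    rwa [show ‖x‖⁻¹ * ‖x‖⁻¹ * (⟪x, C x⟫_ℂ).re * ‖x‖ ^ 2 = (⟪x, C x⟫_ℂ).re by field_simp] at h2
  set P := F.starProjection with hP
  have hPsum : P = ∑ i, InnerProductSpace.rankOne ℂ (stdOrthonormalBasis ℂ F i : H)
      (stdOrthonormalBasis ℂ F i : H) := by
    ext x
    rw [hP, starProjection_apply_of_span_eq (orthonormal_coe_stdOrthonormalBasis F)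
      (span_range_stdOrthonormalBasis F)]
    simp
  have hleft (A : H →L[ℂ] H) : f (A * P) = 0 := by
    rw [hPsum, Finset.mul_sum, map_sum]
    refine Finset.sum_eq_zero fun i _ => ?_
    rw [ContinuousLinearMap.mul_def, InnerProductSpace.comp_rankOne, hrank]
  have hright (A : H →L[ℂ] H) : f (P * A) = 0 := by
    rw [hPsum, Finset.sum_mul, map_sum]
    refine Finset.sum_eq_zero fun i _ => ?_
    rw [ContinuousLinearMap.mul_def, InnerProductSpace.rankOne_comp, hrank]
  have hZ : IsStrictlyAccretive ((1 - P) * C * (1 - P) + (δ : ℂ) • P) := by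
    refine ⟨δ, hδ, fun x => ?_⟩
    have hsymm (x y : H) : ⟪P x, y⟫_ℂ = ⟪x, P y⟫_ℂ := F.inner_starProjection_left_eq_right x y
    have hQ : x - P x ∈ Fᗮ := Submodule.sub_starProjection_mem_orthogonal x
    have e1 : ⟪x, ((1 - P) * C * (1 - P) + (δ : ℂ) • P) x⟫_ℂ =
        ⟪x - P x, C (x - P x)⟫_ℂ + δ * ⟪x, P x⟫_ℂ := by
      simp only [add_apply, mul_apply_eq_comp, sub_apply, one_apply_eq_self, smul_apply,
        inner_add_right, inner_sub_right, inner_smul_right, inner_sub_left, hsymm, map_sub]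
    have e2 : (⟪x, P x⟫_ℂ).re = ‖P x‖ ^ 2 := by
      rw [← hsymm]
      exact F.re_inner_starProjection_eq_normSq x
    have e3 : ‖x‖ ^ 2 = ‖P x‖ ^ 2 + ‖x - P x‖ ^ 2 := by
      rw [Submodule.norm_sq_eq_add_norm_sq_starProjection x F,
        Submodule.starProjection_orthogonal_val]
    rw [e1, Complex.add_re, Complex.re_ofReal_mul, e2, e3]
    linarith [hC' _ hQ]
  have h0 : f ((1 - P) * C * (1 - P) + (δ : ℂ) • P) = 0 := by
    have e : (1 - P) * C * (1 - P) + (δ : ℂ) • P =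
        -(T * Y - Y * T) - P * (C * (1 - P)) - C * P + (δ : ℂ) • (1 * P) := by
      rw [hC]; noncomm_ring
    rw [e, map_add, map_sub, map_sub, map_neg, map_smul, hfT, hleft, hleft, hright]
    simp
  have := hf _ hZ
  rw [h0] at this
  simp at this

end FiniteOperators

/-! ### Duality: almost commuting finite-rank densities. -/

namespace FiniteOperators

variable {H : Type*} [NormedAddCommGroup H] [InnerProductSpace ℂ H]

/-- The functional `X ↦ ⟨y, X x⟩`. -/
noncomputable def innerFunctional (y x : H) : StrongDual ℂ (H →L[ℂ] H) :=
  (innerSL ℂ y).comp (ContinuousLinearMap.apply ℂ H x)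

theorem innerFunctional_apply (y x : H) (X : H →L[ℂ] H) :
    innerFunctional y x X = ⟪y, X x⟫_ℂ := rfl

theorem norm_innerFunctional_le (y x : H) : ‖innerFunctional y x‖ ≤ ‖y‖ * ‖x‖ := by
  refine ContinuousLinearMap.opNorm_le_bound _ (by positivity) fun X => ?_
  rw [innerFunctional_apply]
  refine (norm_inner_le_norm _ _).trans ?_
  rw [mul_assoc, mul_comm ‖x‖]
  gcongr
  exact X.le_opNorm x

variable [CompleteSpace H]

/-- The commutator functional `X ↦ ⟨x, (X T - T X) x⟩`. -/
noncomputable def commutatorFunctional (T : H →L[ℂ] H) (x : H) : StrongDual ℂ (H →L[ℂ] H) :=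
  innerFunctional x (T x) - innerFunctional (ContinuousLinearMap.adjoint T x) x

theorem commutatorFunctional_apply (T : H →L[ℂ] H) (x : H) (X : H →L[ℂ] H) :
    commutatorFunctional T x X = ⟪x, (X * T - T * X) x⟫_ℂ := by
  simp [commutatorFunctional, innerFunctional_apply,
    ContinuousLinearMap.adjoint_inner_left]

/-- On the functionals `X ↦ ⟨y, X x⟩`, an element of the bidual acts as an operator. -/
theorem exists_clm_bidual (g : StrongDual ℂ (StrongDual ℂ (H →L[ℂ] H))) :
    ∃ Y : H →L[ℂ] H, ∀ y x, g (innerFunctional y x) = ⟪y, Y x⟫_ℂ := by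
  obtain ⟨Y, hY⟩ := exists_clm_inner_eq (fun y x => g (innerFunctional y x))
    (fun y y' x => by
      rw [← map_add]; congr 1; ext X; simp [innerFunctional_apply])
    (fun c y x => by
      rw [← smul_eq_mul, ← map_smul]; congr 1; ext X
      simp [innerFunctional_apply, mul_comm])
    (fun y x x' => by
      rw [← map_add]; congr 1; ext X; simp [innerFunctional_apply])
    (fun c y x => by
      rw [← smul_eq_mul, ← map_smul]; congr 1; ext X
      simp [innerFunctional_apply])
    ‖g‖ (fun y x => by
      refine (g.le_opNorm _).trans ?_
      rw [mul_assoc]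
      gcongr
      exact norm_innerFunctional_le y x)
  exact ⟨Y, fun y x => (hY y x).symm⟩

theorem IsFiniteOperator.exists_almost_commuting_density {T : H →L[ℂ] H} (hT : IsFiniteOperator T)
    (hred : ¬ IsFiniteBlockReducible T) (F : Submodule ℂ H) [FiniteDimensional ℂ F] {ε : ℝ}
    (hε : 0 < ε) :
    ∃ (n : ℕ) (x : Fin n → H), (∀ k, x k ∈ Fᗮ) ∧ ∑ k, ‖x k‖ ^ 2 = 1 ∧
      ∀ X : H →L[ℂ] H, ‖∑ k, ⟪x k, (X * T - T * X) (x k)⟫_ℂ‖ ≤ ε * ‖X‖ := by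
  set S : Set (StrongDual ℂ (H →L[ℂ] H)) :=
    commutatorFunctional T '' {x | x ∈ Fᗮ ∧ ‖x‖ = 1} with hS
  -- Norm-closed separation produces an element `g` of the bidual of `H →L[ℂ] H`, but on commutator
  -- functionals it acts as an honest operator `Y`, which contradicts the previous lemma.
  have h0 : (0 : StrongDual ℂ (H →L[ℂ] H)) ∈ closure (convexHull ℝ S) := by
    by_contra h
    obtain ⟨g, u, hg0, hg⟩ := RCLike.geometric_hahn_banach_point_closed (𝕜 := ℂ)
      (convex_convexHull ℝ S).closure isClosed_closure h
    obtain ⟨Y, hY⟩ := exists_clm_bidual g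
    rw [map_zero] at hg0
    obtain ⟨x, hxF, hx1, hxlt⟩ := hT.exists_unit_orthogonal_re_inner_lt hred F Y (δ := u) hg0
    have h1 := hg _ (subset_closure (subset_convexHull ℝ S ⟨x, ⟨hxF, hx1⟩, rfl⟩))
    have h2 : g (commutatorFunctional T x) = ⟪x, (Y * T - T * Y) x⟫_ℂ := by
      rw [commutatorFunctional, map_sub, hY, hY, ContinuousLinearMap.adjoint_inner_left]
      simp
    rw [h2] at h1
    exact lt_asymm h1 hxlt
  obtain ⟨φ, hφ, hφε⟩ := Metric.mem_closure_iff.mp h0 ε hε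
  obtain ⟨ι, _, w, z, hw0, hw1, hz, rfl⟩ := mem_convexHull_iff_exists_fintype.mp hφ
  choose x hx hxz using hz
  rw [dist_zero_left] at hφε
  let e := (Fintype.equivFin ι).symm
  -- The convex weights are absorbed into the vectors through their square roots.
  refine ⟨Fintype.card ι, fun k => ((√(w (e k)) : ℝ) : ℂ) • x (e k),
    fun k => Submodule.smul_mem _ _ (hx _).1, ?_, fun X => ?_⟩
  · rw [← hw1, ← e.sum_comp]
    refine Finset.sum_congr rfl fun k _ => ?_
    rw [norm_smul, (hx _).2, Complex.norm_real, mul_one, Real.norm_eq_abs, sq_abs,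
      Real.sq_sqrt (hw0 _)]
  · have h1 : ∑ k, ⟪((√(w (e k)) : ℝ) : ℂ) • x (e k),
        (X * T - T * X) (((√(w (e k)) : ℝ) : ℂ) • x (e k))⟫_ℂ = (∑ i, w i • z i) X := by
      rw [sum_apply, ← e.sum_comp]
      refine Finset.sum_congr rfl fun k _ => ?_
      rw [smul_apply, ← hxz, commutatorFunctional_apply, map_smul, inner_smul_left,
        inner_smul_right, Complex.conj_ofReal, ← mul_assoc, ← Complex.ofReal_mul,
        Real.mul_self_sqrt (hw0 _), Complex.real_smul]
    rw [h1]
    refine ((∑ i, w i • z i).le_opNorm X).trans ?_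
    gcongr

end FiniteOperators

/-! ### Diagonalization of densities and the level set argument. -/

namespace FiniteOperators

variable {H : Type*} [NormedAddCommGroup H] [InnerProductSpace ℂ H]

/-- A symmetric operator is diagonalized on any finite-dimensional subspace by an orthonormal basis
of it. -/
theorem exists_orthonormal_diagonalizing {S : H →L[ℂ] H} (hS : ∀ x y, ⟪S x, y⟫_ℂ = ⟪x, S y⟫_ℂ)
    (G : Submodule ℂ H) [FiniteDimensional ℂ G] :
    ∃ (n : ℕ) (e : Fin n → H) (d : Fin n → ℝ), Orthonormal ℂ e ∧
      Submodule.span ℂ (Set.range e) = G ∧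
      ∀ i j, ⟪e j, S (e i)⟫_ℂ = if j = i then (d i : ℂ) else 0 := by
  let A : G →ₗ[ℂ] G :=
    (G.orthogonalProjectionOnto : H →ₗ[ℂ] G) ∘ₗ (S : H →ₗ[ℂ] H) ∘ₗ G.subtype
  have hinner (x y : G) : ⟪x, A y⟫_ℂ = ⟪(x : H), S y⟫_ℂ := by
    have := G.inner_starProjection_left_eq_right (x : H) (S y)
    rw [Submodule.starProjection_eq_self_iff.mpr x.2] at this
    exact this.symm
  have hA : A.IsSymmetric := fun x y => by
    rw [hinner, ← inner_conj_symm, hinner, inner_conj_symm, hS]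
  let b := hA.eigenvectorBasis rfl
  refine ⟨Module.finrank ℂ G, fun i => (b i : H), hA.eigenvalues rfl,
    b.orthonormal.comp_linearIsometry G.subtypeₗᵢ, ?_, fun i j => ?_⟩
  · have h := congrArg (Submodule.map G.subtype) b.toBasis.span_eq
    rw [Submodule.map_span, ← Set.range_comp, Submodule.map_subtype_top] at h
    simpa [Function.comp_def] using h
  · rw [← hinner, hA.apply_eigenvectorBasis, inner_smul_right,
      orthonormal_iff_ite.mp b.orthonormal]
    split_ifs <;> simp

/-- A finite sum of rank one positive operators is diagonalized by an orthonormal family. -/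
theorem exists_orthonormal_sum_inner_eq {m : ℕ} (x : Fin m → H) :
    ∃ (n : ℕ) (e : Fin n → H) (d : Fin n → ℝ), Orthonormal ℂ e ∧
      (∀ i, e i ∈ Submodule.span ℂ (Set.range x)) ∧ (∀ i, 0 ≤ d i) ∧
      ∀ Y : H →L[ℂ] H, ∑ k, ⟪x k, Y (x k)⟫_ℂ = ∑ i, d i * ⟪e i, Y (e i)⟫_ℂ := by
  set G := Submodule.span ℂ (Set.range x) with hG
  have : FiniteDimensional ℂ G := FiniteDimensional.span_of_finite ℂ (Set.finite_range x)
  let R : H →L[ℂ] H := ∑ k, InnerProductSpace.rankOne ℂ (x k) (x k)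
  have hR (y z : H) : ⟪y, R z⟫_ℂ = ∑ k, ⟪x k, z⟫_ℂ * ⟪y, x k⟫_ℂ := by
    simp [R, sum_apply]
  obtain ⟨n, e, d, he, hspan, hd⟩ := exists_orthonormal_diagonalizing (S := R) (fun y z => by
    rw [← inner_conj_symm, hR, hR, map_sum]
    refine Finset.sum_congr rfl fun k _ => ?_
    rw [map_mul, inner_conj_symm, inner_conj_symm, mul_comm]) G
  have hx (k) : x k = ∑ i, ⟪e i, x k⟫_ℂ • e i := by
    rw [← starProjection_apply_of_span_eq he hspan]
    exact (Submodule.starProjection_eq_self_iff.mpr (Submodule.subset_span (Set.mem_range_self k))).symm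
  refine ⟨n, e, d, he, fun i => hspan.le (Submodule.subset_span (Set.mem_range_self i)), fun i => ?_, fun Y => ?_⟩
  · have h := hd i i
    rw [if_pos rfl, hR] at h
    have h2 : (d i) = ∑ k, ‖⟪e i, x k⟫_ℂ‖ ^ 2 := by
      rw [← Complex.ofReal_inj, ← h]
      push_cast
      refine Finset.sum_congr rfl fun k _ => ?_
      rw [← inner_conj_symm (x k), Complex.conj_mul']
    rw [h2]
    positivity
  · calc ∑ k, ⟪x k, Y (x k)⟫_ℂ
        = ∑ k, ∑ i, ∑ j, (⟪x k, e i⟫_ℂ * ⟪e j, x k⟫_ℂ) * ⟪e i, Y (e j)⟫_ℂ := by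
          refine Finset.sum_congr rfl fun k _ => ?_
          conv_lhs => rw [hx k]
          simp only [map_sum, map_smul, sum_inner, inner_sum, inner_smul_left, inner_smul_right,
            inner_conj_symm]
          rw [Finset.sum_comm]
          refine Finset.sum_congr rfl fun i _ => ?_
          rw [Finset.mul_sum]
          refine Finset.sum_congr rfl fun j _ => ?_
          ring
      _ = ∑ i, ∑ j, ⟪e j, R (e i)⟫_ℂ * ⟪e i, Y (e j)⟫_ℂ := by
          rw [Finset.sum_comm]
          refine Finset.sum_congr rfl fun i _ => ?_
          rw [Finset.sum_comm]
          refine Finset.sum_congr rfl fun j _ => ?_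
          rw [hR, Finset.sum_mul]
      _ = _ := by
          refine Finset.sum_congr rfl fun i _ => ?_
          simp [hd]

/-- Level sets: if the average of `c #I_a - ∑_{I_a × I_a} w` over the superlevel sets `I_a` of `l`
is small, then so is one of these quantities relative to `#I_a`. -/
theorem exists_superlevel_set {ι : Type*} [Fintype ι] {l : ι → ℝ} (hl : ∀ i, 0 ≤ l i)
    (w : ι → ι → ℝ) {c δ : ℝ}
    (h : c * ∑ i, l i - ∑ i, ∑ j, w i j * min (l i) (l j) < δ * ∑ i, l i) :
    ∃ I : Finset ι, I.Nonempty ∧ c * I.card - ∑ i ∈ I, ∑ j ∈ I, w i j < δ * I.card := by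
  classical
  by_contra! hcon
  have hcon' (I : Finset ι) : 0 ≤ (c - δ) * I.card - ∑ i ∈ I, ∑ j ∈ I, w i j := by
    rcases I.eq_empty_or_nonempty with rfl | hI
    · simp
    · linarith [hcon I hI]
  obtain ⟨M, hM⟩ : ∃ M : ℝ, ∀ i, l i ≤ M := by
    refine ⟨∑ i, l i, fun i => Finset.single_le_sum (fun i _ => hl i) (Finset.mem_univ i)⟩
  -- Layer cake: `χ t` integrates to `t`, and `χ (min (l i) (l j)) a` says that both `i` and `j` lie
  -- in the superlevel set at height `a`. Integrating `hcon'` over `a` contradicts `h`.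
  let χ : ℝ → ℝ → ℝ := fun t a => (Set.Iio t).indicator 1 a
  have hint (t : ℝ) : MeasureTheory.IntegrableOn (χ t) (Set.Ioc 0 M) := by
    refine MeasureTheory.Integrable.indicator ?_ measurableSet_Iio
    exact MeasureTheory.integrable_const _
  have hval (t : ℝ) (h0 : 0 ≤ t) (hM : t ≤ M) : ∫ a in Set.Ioc 0 M, χ t a = t := by
    rw [MeasureTheory.setIntegral_indicator measurableSet_Iio]
    have : Set.Ioc 0 M ∩ Set.Iio t = Set.Ioo 0 t := by
      ext a
      simp only [Set.mem_inter_iff, Set.mem_Ioc, Set.mem_Iio, Set.mem_Ioo]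
      constructor
      · exact fun h => ⟨h.1.1, h.2⟩
      · exact fun h => ⟨⟨h.1, h.2.le.trans hM⟩, h.2⟩
    rw [this]
    simp [h0]
  have hnonneg (a : ℝ) :
      0 ≤ (c - δ) * ∑ i, χ (l i) a - ∑ i, ∑ j, w i j * χ (min (l i) (l j)) a := by
    convert hcon' (Finset.univ.filter fun i => a < l i) using 2
    · simp [χ, Set.indicator_apply, Finset.sum_boole]
    · rw [Finset.sum_filter]
      refine Finset.sum_congr rfl fun i _ => ?_
      rw [Finset.sum_filter]
      split_ifs with hi
      · refine Finset.sum_congr rfl fun j _ => ?_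
        simp [χ, Set.indicator_apply, hi]
      · simp [χ, Set.indicator_apply, hi]
  have hI := MeasureTheory.integral_nonneg (μ := MeasureTheory.volume.restrict (Set.Ioc 0 M))
    (f := fun a => (c - δ) * ∑ i, χ (l i) a - ∑ i, ∑ j, w i j * χ (min (l i) (l j)) a) hnonneg
  rw [MeasureTheory.integral_sub
    ((MeasureTheory.integrable_finsetSum _ fun i _ => hint _).const_mul _)
    (MeasureTheory.integrable_finsetSum _ fun i _ =>
      MeasureTheory.integrable_finsetSum _ fun j _ => (hint _).const_mul _),
    MeasureTheory.integral_const_mul, MeasureTheory.integral_finsetSum _ fun i _ => hint _,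
    MeasureTheory.integral_finsetSum _ fun i _ =>
      MeasureTheory.integrable_finsetSum _ fun j _ => (hint _).const_mul _] at hI
  have e1 : ∑ i, ∫ a in Set.Ioc 0 M, χ (l i) a = ∑ i, l i :=
    Finset.sum_congr rfl fun i _ => hval _ (hl i) (hM i)
  have e2 : ∑ i, ∫ a in Set.Ioc 0 M, ∑ j, w i j * χ (min (l i) (l j)) a =
      ∑ i, ∑ j, w i j * min (l i) (l j) := by
    refine Finset.sum_congr rfl fun i _ => ?_
    rw [MeasureTheory.integral_finsetSum _ fun j _ => (hint _).const_mul _]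
    refine Finset.sum_congr rfl fun j _ => ?_
    rw [MeasureTheory.integral_const_mul, hval _ (le_min (hl i) (hl j)) (min_le_of_left_le (hM i))]
  rw [e1, e2] at hI
  linarith

end FiniteOperators

/-! ### The Powers-Størmer inequality and the Connes trick. -/

namespace FiniteOperators

variable {H : Type*} [NormedAddCommGroup H] [InnerProductSpace ℂ H]

/-- The operator that is diagonal with real eigenvalues `a` along the family `e`. -/
noncomputable def diagOp {ι : Type*} [Fintype ι] (e : ι → H) (a : ι → ℝ) : H →L[ℂ] H :=
  ∑ i, (a i : ℂ) • InnerProductSpace.rankOne ℂ (e i) (e i)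

section diagOp

variable {ι : Type*} [Fintype ι]

theorem diagOp_apply (e : ι → H) (a : ι → ℝ) (x : H) :
    diagOp e a x = ∑ i, ((a i : ℂ) * ⟪e i, x⟫_ℂ) • e i := by
  simp [diagOp, sum_apply, mul_smul]

theorem inner_diagOp (e : ι → H) (a : ι → ℝ) (x y : H) :
    ⟪y, diagOp e a x⟫_ℂ = ∑ i, (a i : ℂ) * (⟪y, e i⟫_ℂ * ⟪e i, x⟫_ℂ) := by
  rw [diagOp_apply, inner_sum]
  refine Finset.sum_congr rfl fun i _ => ?_
  rw [inner_smul_right]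
  ring

theorem diagOp_inner (e : ι → H) (a : ι → ℝ) (x y : H) :
    ⟪diagOp e a x, y⟫_ℂ = ∑ i, (a i : ℂ) * (⟪x, e i⟫_ℂ * ⟪e i, y⟫_ℂ) := by
  rw [diagOp_apply, sum_inner]
  refine Finset.sum_congr rfl fun i _ => ?_
  rw [inner_smul_left, map_mul, Complex.conj_ofReal, inner_conj_symm]
  ring

theorem diagOp_inner_eq (e : ι → H) (a : ι → ℝ) (x y : H) :
    ⟪diagOp e a x, y⟫_ℂ = ⟪x, diagOp e a y⟫_ℂ := by
  rw [diagOp_inner, inner_diagOp]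

theorem inner_mul_inner_self (x y : H) : ⟪x, y⟫_ℂ * ⟪y, x⟫_ℂ = ((‖⟪y, x⟫_ℂ‖ ^ 2 : ℝ) : ℂ) := by
  rw [← inner_conj_symm x y, Complex.conj_mul']
  push_cast
  rfl

theorem re_inner_diagOp_self (e : ι → H) (a : ι → ℝ) (x : H) :
    (⟪x, diagOp e a x⟫_ℂ).re = ∑ i, a i * ‖⟪e i, x⟫_ℂ‖ ^ 2 := by
  rw [inner_diagOp, Complex.re_sum]
  refine Finset.sum_congr rfl fun i _ => ?_
  rw [inner_mul_inner_self, ← Complex.ofReal_mul, Complex.ofReal_re]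

theorem norm_diagOp_apply_sq {e : ι → H} (he : Orthonormal ℂ e) (a : ι → ℝ) (x : H) :
    ‖diagOp e a x‖ ^ 2 = ∑ i, a i ^ 2 * ‖⟪e i, x⟫_ℂ‖ ^ 2 := by
  classical
  have h : diagOp e a (diagOp e a x) = diagOp e (fun i => a i ^ 2) x := by
    rw [diagOp_apply, diagOp_apply e (fun i => a i ^ 2)]
    refine Finset.sum_congr rfl fun i _ => ?_
    congr 1
    rw [inner_diagOp]
    simp [orthonormal_iff_ite.mp he]
    ring
  have h2 : (⟪diagOp e a x, diagOp e a x⟫_ℂ).re = ‖diagOp e a x‖ ^ 2 :=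
    inner_self_eq_norm_sq (𝕜 := ℂ) _
  rw [← h2, diagOp_inner_eq, h, re_inner_diagOp_self]

theorem norm_diagOp_le_one {e : ι → H} (he : Orthonormal ℂ e) {a : ι → ℝ} (ha : ∀ i, |a i| ≤ 1) :
    ‖diagOp e a‖ ≤ 1 := by
  refine ContinuousLinearMap.opNorm_le_bound _ zero_le_one fun x => ?_
  rw [one_mul, ← sq_le_sq₀ (norm_nonneg _) (norm_nonneg _), norm_diagOp_apply_sq he]
  refine le_trans (Finset.sum_le_sum fun i _ => ?_) (he.sum_inner_products_le x (s := Finset.univ))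
  exact mul_le_of_le_one_left (sq_nonneg _) ((sq_le_one_iff_abs_le_one _).mpr (ha i))

theorem diagOp_mem_of_forall_mem {e : ι → H} {a : ι → ℝ} {G : Submodule ℂ H} (h : ∀ i, e i ∈ G)
    (x : H) : diagOp e a x ∈ G := by
  rw [diagOp_apply]
  exact Submodule.sum_mem _ fun i _ => Submodule.smul_mem _ _ (h i)

end diagOp

theorem sum_inner_mul_inner_of_mem {ι : Type*} [Fintype ι] {v : ι → H} (hv : Orthonormal ℂ v)
    {G : Submodule ℂ H} [G.HasOrthogonalProjection] (hG : Submodule.span ℂ (Set.range v) = G)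
    {x : H} (hx : x ∈ G) (y : H) : ∑ m, ⟪x, v m⟫_ℂ * ⟪v m, y⟫_ℂ = ⟪x, y⟫_ℂ := by
  conv_rhs => rw [← Submodule.starProjection_eq_self_iff.mpr hx,
    starProjection_apply_of_span_eq hv hG, sum_inner]
  refine Finset.sum_congr rfl fun m _ => ?_
  rw [inner_smul_left, inner_conj_symm]

theorem sum_norm_inner_sq_of_mem {ι : Type*} [Fintype ι] {v : ι → H} (hv : Orthonormal ℂ v)
    {G : Submodule ℂ H} [G.HasOrthogonalProjection] (hG : Submodule.span ℂ (Set.range v) = G)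
    {x : H} (hx : x ∈ G) : ∑ m, ‖⟪x, v m⟫_ℂ‖ ^ 2 = ‖x‖ ^ 2 := by
  have h := sum_inner_mul_inner_of_mem hv hG hx x
  have h2 : (⟪x, x⟫_ℂ).re = ‖x‖ ^ 2 := inner_self_eq_norm_sq (𝕜 := ℂ) _
  rw [← h2, ← h, Complex.re_sum]
  refine Finset.sum_congr rfl fun m _ => ?_
  rw [inner_mul_inner_self, Complex.ofReal_re, norm_inner_symm]

/-- The Powers-Størmer inequality for finite rank positive operators with the same eigenvalues. -/
theorem exists_contraction_powers_stormer {ι : Type*} [Fintype ι] {e f : ι → H}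
    (he : Orthonormal ℂ e) (hf : Orthonormal ℂ f) {a : ι → ℝ} (ha : ∀ i, 0 ≤ a i) :
    ∃ S : H →L[ℂ] H, ‖S‖ ≤ 1 ∧
      2 * (∑ i, a i ^ 2 - ∑ i, ∑ j, a i * a j * ‖⟪e i, f j⟫_ℂ‖ ^ 2) ≤
        ∑ i, a i ^ 2 * ((⟪f i, S (f i)⟫_ℂ).re - (⟪e i, S (e i)⟫_ℂ).re) := by
  set h := diagOp e a
  set k := diagOp f a
  set G := Submodule.span ℂ (Set.range e ∪ Set.range f) with hGdef
  have : FiniteDimensional ℂ G :=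
    FiniteDimensional.span_of_finite ℂ ((Set.finite_range e).union (Set.finite_range f))
  have heG (i) : e i ∈ G := Submodule.subset_span (Or.inl ⟨i, rfl⟩)
  have hfG (i) : f i ∈ G := Submodule.subset_span (Or.inr ⟨i, rfl⟩)
  -- Work in an eigenbasis `v` of `k - h` on a space containing both ranges; the contraction `S`
  -- will be the sign of `k - h` in this basis.
  obtain ⟨n, v, d, hv, hvG, hd⟩ := exists_orthonormal_diagonalizing (S := k - h) (fun x y => by
    simp only [sub_apply, inner_sub_left, inner_sub_right, h, k, diagOp_inner_eq]) G
  have hDv (m) : k (v m) - h (v m) = (d m : ℂ) • v m := by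
    have hmem : (k - h) (v m) ∈ G :=
      sub_mem (diagOp_mem_of_forall_mem hfG _) (diagOp_mem_of_forall_mem heG _)
    rw [← sub_apply, ← Submodule.starProjection_eq_self_iff.mpr hmem,
      starProjection_apply_of_span_eq hv hvG]
    simp only [hd]
    simp
  have hvv (m) : ⟪v m, v m⟫_ℂ = 1 := by
    rw [inner_self_eq_norm_sq_to_K, hv.norm_eq_one]; simp
  have hd_eq (m) : d m = (⟪v m, k (v m)⟫_ℂ).re - (⟪v m, h (v m)⟫_ℂ).re := by
    rw [← Complex.sub_re, ← inner_sub_right, hDv, inner_smul_right, hvv, mul_one,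
      Complex.ofReal_re]
  have hh0 (m) : 0 ≤ (⟪v m, h (v m)⟫_ℂ).re := by
    rw [re_inner_diagOp_self]
    exact Finset.sum_nonneg fun i _ => mul_nonneg (ha i) (sq_nonneg _)
  have hk0 (m) : 0 ≤ (⟪v m, k (v m)⟫_ℂ).re := by
    rw [re_inner_diagOp_self]
    exact Finset.sum_nonneg fun i _ => mul_nonneg (ha i) (sq_nonneg _)
  have hdiff (m) : ‖k (v m)‖ ^ 2 - ‖h (v m)‖ ^ 2 =
      d m * ((⟪v m, k (v m)⟫_ℂ).re + (⟪v m, h (v m)⟫_ℂ).re) := by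
    have h1 : (⟪k (v m) - h (v m), k (v m) + h (v m)⟫_ℂ).re = ‖k (v m)‖ ^ 2 - ‖h (v m)‖ ^ 2 := by
      have e1 : (⟪k (v m), k (v m)⟫_ℂ).re = ‖k (v m)‖ ^ 2 := inner_self_eq_norm_sq (𝕜 := ℂ) _
      have e2 : (⟪h (v m), h (v m)⟫_ℂ).re = ‖h (v m)‖ ^ 2 := inner_self_eq_norm_sq (𝕜 := ℂ) _
      have e3 : (⟪k (v m), h (v m)⟫_ℂ).re = (⟪h (v m), k (v m)⟫_ℂ).re := by
        rw [← inner_conj_symm, Complex.conj_re]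
      simp only [inner_sub_left, inner_add_right, Complex.sub_re, Complex.add_re, e1, e2, e3]
      ring
    rw [← h1, hDv, inner_smul_left, Complex.conj_ofReal, Complex.re_ofReal_mul, inner_add_right,
      Complex.add_re]
  choose s hs1 hsd using fun m => (show ∃ s : ℝ, |s| ≤ 1 ∧ s * d m = |d m| by
    rcases le_total 0 (d m) with h0 | h0
    · exact ⟨1, by simp, by rw [one_mul, abs_of_nonneg h0]⟩
    · exact ⟨-1, by simp, by rw [abs_of_nonpos h0]; ring⟩)
  -- Positivity of `h` and `k` bounds `|d m|` by the sum of their diagonal entries. Summed over `m`,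
  -- this is `Tr (k - h)² ≤ Tr S(k² - h²)`.
  have hsq (m) : d m ^ 2 ≤ s m * (‖k (v m)‖ ^ 2 - ‖h (v m)‖ ^ 2) := by
    rw [hdiff, ← mul_assoc, hsd, ← sq_abs, sq]
    refine mul_le_mul_of_nonneg_left ?_ (abs_nonneg _)
    rw [hd_eq]
    exact abs_le.mpr ⟨by linarith [hk0 m, hh0 m], by linarith [hk0 m, hh0 m]⟩
  have hsum : ∑ m, d m ^ 2 =
      2 * (∑ i, a i ^ 2 - ∑ i, ∑ j, a i * a j * ‖⟪e i, f j⟫_ℂ‖ ^ 2) := by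
    have h1 (m) : d m ^ 2 = ‖k (v m)‖ ^ 2 - 2 * (⟪h (v m), k (v m)⟫_ℂ).re + ‖h (v m)‖ ^ 2 := by
      have e1 : ‖k (v m) - h (v m)‖ ^ 2 = d m ^ 2 := by
        rw [hDv, norm_smul, hv.norm_eq_one, mul_one, Complex.norm_real, Real.norm_eq_abs, sq_abs]
      rw [← e1, norm_sub_sq (𝕜 := ℂ), ← inner_conj_symm]
      rfl
    have hk : ∑ m, ‖k (v m)‖ ^ 2 = ∑ i, a i ^ 2 := by
      simp only [k, norm_diagOp_apply_sq hf]
      rw [Finset.sum_comm]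
      refine Finset.sum_congr rfl fun i _ => ?_
      rw [← Finset.mul_sum, sum_norm_inner_sq_of_mem hv hvG (hfG i), hf.norm_eq_one]
      ring
    have hh : ∑ m, ‖h (v m)‖ ^ 2 = ∑ i, a i ^ 2 := by
      simp only [h, norm_diagOp_apply_sq he]
      rw [Finset.sum_comm]
      refine Finset.sum_congr rfl fun i _ => ?_
      rw [← Finset.mul_sum, sum_norm_inner_sq_of_mem hv hvG (heG i), he.norm_eq_one]
      ring
    have hcross : ∑ m, (⟪h (v m), k (v m)⟫_ℂ).re =
        ∑ i, ∑ j, a i * a j * ‖⟪e i, f j⟫_ℂ‖ ^ 2 := by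
      have e1 : ∑ m, ⟪h (v m), k (v m)⟫_ℂ =
          ∑ i, ∑ j, (a i : ℂ) * a j * (⟪e i, f j⟫_ℂ * ⟪f j, e i⟫_ℂ) := by
        simp only [h, diagOp_inner]
        simp only [k, inner_diagOp]
        rw [Finset.sum_comm]
        refine Finset.sum_congr rfl fun i _ => ?_
        simp only [Finset.mul_sum]
        rw [Finset.sum_comm]
        refine Finset.sum_congr rfl fun j _ => ?_
        rw [← sum_inner_mul_inner_of_mem hv hvG (hfG j) (e i), Finset.mul_sum, Finset.mul_sum]
        refine Finset.sum_congr rfl fun m _ => ?_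
        ring
      rw [← Complex.re_sum, e1, Complex.re_sum]
      refine Finset.sum_congr rfl fun i _ => ?_
      rw [Complex.re_sum]
      refine Finset.sum_congr rfl fun j _ => ?_
      rw [inner_mul_inner_self, ← Complex.ofReal_mul, ← Complex.ofReal_mul, Complex.ofReal_re,
        norm_inner_symm]
    simp only [h1, Finset.sum_add_distrib, Finset.sum_sub_distrib, ← Finset.mul_sum, hk, hh,
      hcross]
    ring
  refine ⟨diagOp v s, norm_diagOp_le_one hv hs1, ?_⟩
  rw [← hsum]
  refine (Finset.sum_le_sum fun m _ => hsq m).trans_eq ?_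
  simp only [h, k, norm_diagOp_apply_sq he, norm_diagOp_apply_sq hf, re_inner_diagOp_self,
    ← Finset.sum_sub_distrib, Finset.mul_sum]
  rw [Finset.sum_comm]
  refine Finset.sum_congr rfl fun i _ => Finset.sum_congr rfl fun m _ => ?_
  rw [norm_inner_symm (f i), norm_inner_symm (e i)]
  ring

/-- If `p ≤ q`, the left side is `p * (q - p)`, and Young's inequality with parameter `t` applies.
-/
theorem mul_sub_min_sq_le {p q t : ℝ} (hp : 0 ≤ p) (hq : 0 ≤ q) (ht : 0 < t) :
    p * q - min (p ^ 2) (q ^ 2) ≤ t / 2 * min (p ^ 2) (q ^ 2) + (p - q) ^ 2 / (2 * t) := by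
  have key (x y : ℝ) : x * y ≤ t / 2 * x ^ 2 + y ^ 2 / (2 * t) := by
    rw [← sub_nonneg]
    have : t / 2 * x ^ 2 + y ^ 2 / (2 * t) - x * y = (t * x - y) ^ 2 / (2 * t) := by
      field_simp
      ring
    rw [this]
    positivity
  rcases le_total p q with h | h
  · rw [min_eq_left (pow_le_pow_left₀ hp h 2)]
    rw [sub_sq_comm p q]
    linarith [key p (q - p)]
  · rw [min_eq_right (pow_le_pow_left₀ hq h 2)]
    linarith [key q (p - q)]

/-- The Connes trick: closeness of the square roots controls the minimum of the eigenvalues. -/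
theorem one_sub_sum_min_le {ι : Type*} [Fintype ι] {d : ι → ℝ} (hd : ∀ i, 0 ≤ d i)
    (hd1 : ∑ i, d i = 1) {w : ι → ι → ℝ} (hw : ∀ i j, 0 ≤ w i j) (hrow : ∀ i, ∑ j, w i j ≤ 1)
    (hcol : ∀ j, ∑ i, w i j ≤ 1) {t : ℝ} (ht : 0 < t)
    (h : 1 - ∑ i, ∑ j, √(d i) * √(d j) * w i j ≤ t ^ 2 / 2) :
    1 - ∑ i, ∑ j, w i j * min (d i) (d j) ≤ t ^ 2 / 2 + t := by
  have hr : ∑ i, ∑ j, w i j * d i ≤ 1 := by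
    rw [← hd1]
    refine Finset.sum_le_sum fun i _ => ?_
    rw [← Finset.sum_mul]
    exact mul_le_of_le_one_left (hd i) (hrow i)
  have hc : ∑ i, ∑ j, w i j * d j ≤ 1 := by
    rw [← hd1, Finset.sum_comm]
    refine Finset.sum_le_sum fun i _ => ?_
    rw [← Finset.sum_mul]
    exact mul_le_of_le_one_left (hd i) (hcol i)
  have hterm (i j) : √(d i) * √(d j) * w i j - w i j * min (d i) (d j) ≤
      t / 2 * (w i j * d i) + (1 / (2 * t)) * (w i j * d i + w i j * d j -
        2 * (√(d i) * √(d j) * w i j)) := by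
    have h1 := mul_sub_min_sq_le (p := √(d i)) (q := √(d j))
      (Real.sqrt_nonneg _) (Real.sqrt_nonneg _) ht
    rw [Real.sq_sqrt (hd i), Real.sq_sqrt (hd j)] at h1
    have h2 : (√(d i) - √(d j)) ^ 2 = d i + d j - 2 * (√(d i) * √(d j)) := by
      rw [sub_sq, Real.sq_sqrt (hd i), Real.sq_sqrt (hd j)]; ring
    rw [h2] at h1
    have h3 : t / 2 * min (d i) (d j) ≤ t / 2 * d i := by
      gcongr; exact min_le_left _ _
    have h4 := mul_le_mul_of_nonneg_left (h1.trans (add_le_add_left h3 _)) (hw i j)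
    calc _ = w i j * (√(d i) * √(d j) - min (d i) (d j)) := by ring
      _ ≤ _ := h4
      _ = _ := by ring
  have hsum := Finset.sum_le_sum fun i (_ : i ∈ Finset.univ) =>
    Finset.sum_le_sum fun j (_ : j ∈ Finset.univ) => hterm i j
  simp only [Finset.sum_add_distrib, Finset.sum_sub_distrib, ← Finset.mul_sum] at hsum
  set σ := ∑ i, ∑ j, √(d i) * √(d j) * w i j
  -- The bracket is at most `2 - 2σ ≤ t²`, since both weighted sums of `d` are at most `1`.
  have h5 : 1 / (2 * t) * (∑ i, ∑ j, w i j * d i + ∑ i, ∑ j, w i j * d j - 2 * σ) ≤ t / 2 := by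
    rw [div_mul_eq_mul_div, one_mul, div_le_iff₀ (by positivity)]
    nlinarith
  nlinarith

end FiniteOperators

/-! ### From densities to spectral projections for unitaries; the Cayley transform. -/

namespace FiniteOperators

variable {H : Type*} [NormedAddCommGroup H] [InnerProductSpace ℂ H]

theorem norm_starProjection_sq_of_span_eq {ι : Type*} [Fintype ι] {e : ι → H}
    (he : Orthonormal ℂ e) {V : Submodule ℂ H} [V.HasOrthogonalProjection]
    (hV : Submodule.span ℂ (Set.range e) = V) (x : H) :
    ‖V.starProjection x‖ ^ 2 = ∑ i, ‖⟪e i, x⟫_ℂ‖ ^ 2 := by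
  have h : diagOp e (fun _ => 1) x = V.starProjection x := by
    rw [diagOp_apply, starProjection_apply_of_span_eq he hV]
    simp
  rw [← h, norm_diagOp_apply_sq he]
  simp

variable [CompleteSpace H]

theorem hsSq_corner_eq {ι : Type*} [Fintype ι] {e : ι → H}
    (he : Orthonormal ℂ e) {V : Submodule ℂ H} [V.HasOrthogonalProjection]
    (hV : Submodule.span ℂ (Set.range e) = V) {u : H →L[ℂ] H} (hu : ∀ x, ‖u x‖ = ‖x‖) :
    hsSq ((1 - V.starProjection) * u * V.starProjection) =
      ENNReal.ofReal (Fintype.card ι - ∑ i, ∑ j, ‖⟪e i, u (e j)⟫_ℂ‖ ^ 2) := by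
  rw [hsSq_mul_starProjection_of_span_eq he hV]
  simp only [← ofReal_norm, ← ENNReal.ofReal_pow (norm_nonneg _)]
  rw [← ENNReal.ofReal_sum_of_nonneg fun i _ => by positivity]
  congr 1
  have h (x : H) : ‖(1 - V.starProjection) x‖ ^ 2 = ‖x‖ ^ 2 - ∑ i, ‖⟪e i, x⟫_ℂ‖ ^ 2 := by
    rw [Submodule.norm_sq_eq_add_norm_sq_starProjection x V,
      Submodule.starProjection_orthogonal_val, norm_starProjection_sq_of_span_eq he hV]
    simp
  simp only [mul_apply_eq_comp, h, hu, he.norm_eq_one, Finset.sum_sub_distrib]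
  rw [Finset.sum_comm]
  simp

theorem norm_apply_of_adjoint_mul_eq_one {u : H →L[ℂ] H}
    (hu : ContinuousLinearMap.adjoint u * u = 1) (x : H) : ‖u x‖ = ‖x‖ := by
  have h1 : (⟪u x, u x⟫_ℂ).re = ‖u x‖ ^ 2 := inner_self_eq_norm_sq (𝕜 := ℂ) _
  have h2 : (⟪x, x⟫_ℂ).re = ‖x‖ ^ 2 := inner_self_eq_norm_sq (𝕜 := ℂ) _
  have h3 := congrArg (· x) hu
  simp only [mul_apply_eq_comp, one_apply_eq_self] at h3
  rw [← ContinuousLinearMap.adjoint_inner_right, h3, h2] at h1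
  exact (pow_left_inj₀ (norm_nonneg _) (norm_nonneg _) two_ne_zero).mp h1.symm

/-- The commutator is the difference of the two off-diagonal corners of `u`. The adjoint of one is a
corner of `u*`, with the same total overlap, so both corners have the same size and the constant is
`2 + 2`. -/
theorem hsSq_commutator_starProjection_le {ι : Type*} [Fintype ι] {e : ι → H}
    (he : Orthonormal ℂ e) {V : Submodule ℂ H} [V.HasOrthogonalProjection]
    (hV : Submodule.span ℂ (Set.range e) = V) {u : H →L[ℂ] H}
    (hu : ContinuousLinearMap.adjoint u * u = 1) (hu' : u * ContinuousLinearMap.adjoint u = 1) :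
    hsSq (u * V.starProjection - V.starProjection * u) ≤
      4 * ENNReal.ofReal (Fintype.card ι - ∑ i, ∑ j, ‖⟪e i, u (e j)⟫_ℂ‖ ^ 2) := by
  set P := V.starProjection with hP
  have hsa : ContinuousLinearMap.adjoint P = P := (isSelfAdjoint_starProjection V).adjoint_eq
  have h1 : u * P - P * u = (1 - P) * u * P - P * u * (1 - P) := by noncomm_ring
  have h2 : ContinuousLinearMap.adjoint (P * u * (1 - P)) =
      (1 - P) * ContinuousLinearMap.adjoint u * P := by
    have : star P = P := hsa
    simp only [← ContinuousLinearMap.star_eq_adjoint, star_mul, star_sub, star_one, this, mul_assoc]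
  have h3 : ∑ i, ∑ j, ‖⟪e i, ContinuousLinearMap.adjoint u (e j)⟫_ℂ‖ ^ 2 =
      ∑ i, ∑ j, ‖⟪e i, u (e j)⟫_ℂ‖ ^ 2 := by
    rw [Finset.sum_comm]
    refine Finset.sum_congr rfl fun i _ => Finset.sum_congr rfl fun j _ => ?_
    rw [ContinuousLinearMap.adjoint_inner_right, norm_inner_symm]
  rw [h1]
  refine (hsSq_sub_le _ _).trans_eq ?_
  rw [← hsSq_adjoint (P * u * (1 - P)), h2,
    hsSq_corner_eq he hV (norm_apply_of_adjoint_mul_eq_one hu),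
    hsSq_corner_eq he hV (norm_apply_of_adjoint_mul_eq_one (by
      rwa [ContinuousLinearMap.adjoint_adjoint])), h3]
  ring

theorem one_sub_sum_min_inner_le {ι : Type*} [Fintype ι] {e : ι → H} (he : Orthonormal ℂ e)
    {d : ι → ℝ} (hd : ∀ i, 0 ≤ d i) (hd1 : ∑ i, d i = 1) {u : H →L[ℂ] H}
    (hu : ContinuousLinearMap.adjoint u * u = 1) (hu' : u * ContinuousLinearMap.adjoint u = 1)
    {t : ℝ} (ht : 0 < t)
    (h : ∀ X : H →L[ℂ] H, ‖∑ i, d i * ⟪e i, (X * u - u * X) (e i)⟫_ℂ‖ ≤ t ^ 2 * ‖X‖) :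
    1 - ∑ i, ∑ j, ‖⟪e i, u (e j)⟫_ℂ‖ ^ 2 * min (d i) (d j) ≤ t ^ 2 / 2 + t := by
  have hnorm := norm_apply_of_adjoint_mul_eq_one hu
  have hnorm' := norm_apply_of_adjoint_mul_eq_one
    (u := ContinuousLinearMap.adjoint u) (by rwa [ContinuousLinearMap.adjoint_adjoint])
  have hu_inner (x y : H) : ⟪u x, u y⟫_ℂ = ⟪x, y⟫_ℂ := by
    have h3 := congrArg (· y) hu
    simp only [mul_apply_eq_comp, one_apply_eq_self] at h3
    rw [← ContinuousLinearMap.adjoint_inner_right, h3]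
  have hf : Orthonormal ℂ fun i => u (e i) := by
    classical
    rw [orthonormal_iff_ite]
    intro i j
    rw [hu_inner, orthonormal_iff_ite.mp he]
  obtain ⟨S, hS1, hS⟩ := exists_contraction_powers_stormer he hf (a := fun i => √(d i))
    fun i => Real.sqrt_nonneg _
  refine one_sub_sum_min_le hd hd1 (fun i j => by positivity) (fun i => ?_) (fun j => ?_) ht ?_
  · have h1 := he.sum_inner_products_le (ContinuousLinearMap.adjoint u (e i)) (s := Finset.univ)
    rw [hnorm', he.norm_eq_one, one_pow] at h1
    refine le_trans (Finset.sum_le_sum fun j _ => ?_) h1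
    rw [ContinuousLinearMap.adjoint_inner_right, norm_inner_symm]
  · have h1 := he.sum_inner_products_le (u (e j)) (s := Finset.univ)
    rwa [hnorm, he.norm_eq_one, one_pow] at h1
  simp only [fun i => Real.sq_sqrt (hd i), hd1] at hS
  -- For `X = u*S` the commutator `Xu - uX` equals `u*Su - S`, whose weighted trace is the right
  -- side of the Powers-Størmer inequality for `e` and `u e`.
  have hX := h (ContinuousLinearMap.adjoint u * S)
  have hXn : ‖ContinuousLinearMap.adjoint u * S‖ ≤ 1 := by
    refine ContinuousLinearMap.opNorm_le_bound _ zero_le_one fun x => ?_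
    rw [mul_apply_eq_comp, hnorm']
    exact S.le_of_opNorm_le hS1 x
  have hval : (∑ i, d i * ⟪e i, (ContinuousLinearMap.adjoint u * S * u -
      u * (ContinuousLinearMap.adjoint u * S)) (e i)⟫_ℂ).re =
      ∑ i, d i * ((⟪u (e i), S (u (e i))⟫_ℂ).re - (⟪e i, S (e i)⟫_ℂ).re) := by
    rw [Complex.re_sum]
    refine Finset.sum_congr rfl fun i _ => ?_
    rw [Complex.re_ofReal_mul, ← mul_assoc u, hu', one_mul]
    simp only [sub_apply, mul_apply_eq_comp, inner_sub_right, Complex.sub_re,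
      ContinuousLinearMap.adjoint_inner_right]
  have h1 := (Complex.re_le_norm _).trans hX
  rw [hval] at h1
  have h2 : t ^ 2 * ‖ContinuousLinearMap.adjoint u * S‖ ≤ t ^ 2 :=
    mul_le_of_le_one_right (sq_nonneg t) hXn
  linarith

/-- If two unitaries almost commute with a finite rank density, they almost commute with one of its
spectral projections. -/
theorem exists_subfamily_almost_commuting {n : ℕ} {e : Fin n → H} (he : Orthonormal ℂ e)
    {d : Fin n → ℝ} (hd : ∀ i, 0 ≤ d i) (hd1 : ∑ i, d i = 1) {u v : H →L[ℂ] H}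
    (hu : ContinuousLinearMap.adjoint u * u = 1) (hu' : u * ContinuousLinearMap.adjoint u = 1)
    (hv : ContinuousLinearMap.adjoint v * v = 1) (hv' : v * ContinuousLinearMap.adjoint v = 1)
    {t : ℝ} (ht : 0 < t) (ht1 : t ≤ 1)
    (h : ∀ X : H →L[ℂ] H, ‖∑ i, d i * ⟪e i, (X * u - u * X) (e i)⟫_ℂ‖ ≤ t ^ 2 * ‖X‖)
    (h' : ∀ X : H →L[ℂ] H, ‖∑ i, d i * ⟪e i, (X * v - v * X) (e i)⟫_ℂ‖ ≤ t ^ 2 * ‖X‖) :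
    ∃ I : Finset (Fin n), I.Nonempty ∧ ∀ (V : Submodule ℂ H) [V.HasOrthogonalProjection],
      Submodule.span ℂ (Set.range fun i : I => e i) = V →
      hsSq (u * V.starProjection - V.starProjection * u) ≤ ENNReal.ofReal (16 * t * I.card) ∧
      hsSq (v * V.starProjection - V.starProjection * v) ≤ ENNReal.ofReal (16 * t * I.card) := by
  have h1 := one_sub_sum_min_inner_le he hd hd1 hu hu' ht h
  have h2 := one_sub_sum_min_inner_le he hd hd1 hv hv' ht h'
  -- One level set must serve both unitaries, so their overlaps are added and `c = 2`. Each deficit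
  -- is non-negative by Bessel, so smallness of the sum controls both. The value `4 * t` exceeds `2
  -- * (t ^ 2 / 2 + t)` because `t ≤ 1`.
  obtain ⟨I, hI, hIw⟩ := exists_superlevel_set hd
    (fun i j => ‖⟪e i, u (e j)⟫_ℂ‖ ^ 2 + ‖⟪e i, v (e j)⟫_ℂ‖ ^ 2) (c := 2) (δ := 4 * t) (by
      simp only [add_mul, Finset.sum_add_distrib, hd1]
      nlinarith)
  simp only [Finset.sum_add_distrib] at hIw
  have heI : Orthonormal ℂ fun i : I => e i := he.comp _ Subtype.coe_injective
  have hle (w : H →L[ℂ] H) (hw : ContinuousLinearMap.adjoint w * w = 1) :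
      ∑ i ∈ I, ∑ j ∈ I, ‖⟪e i, w (e j)⟫_ℂ‖ ^ 2 ≤ I.card := by
    rw [Finset.sum_comm, ← nsmul_one, ← Finset.sum_const]
    refine Finset.sum_le_sum fun j _ => ?_
    have h1 := he.sum_inner_products_le (w (e j)) (s := I)
    rwa [norm_apply_of_adjoint_mul_eq_one hw, he.norm_eq_one, one_pow] at h1
  have hconv (w : H →L[ℂ] H) : ∑ i : I, ∑ j : I, ‖⟪e i, w (e j)⟫_ℂ‖ ^ 2 =
      ∑ i ∈ I, ∑ j ∈ I, ‖⟪e i, w (e j)⟫_ℂ‖ ^ 2 := by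
    rw [← Finset.sum_coe_sort I]
    refine Finset.sum_congr rfl fun i _ => ?_
    rw [← Finset.sum_coe_sort I]
  have hfin (w : H →L[ℂ] H) (hw : ContinuousLinearMap.adjoint w * w = 1)
      (hw' : w * ContinuousLinearMap.adjoint w = 1)
      (hsmall : I.card - ∑ i ∈ I, ∑ j ∈ I, ‖⟪e i, w (e j)⟫_ℂ‖ ^ 2 ≤ 4 * t * I.card)
      (V : Submodule ℂ H) [V.HasOrthogonalProjection]
      (hV : Submodule.span ℂ (Set.range fun i : I => e i) = V) :
      hsSq (w * V.starProjection - V.starProjection * w) ≤ ENNReal.ofReal (16 * t * I.card) := by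
    refine (hsSq_commutator_starProjection_le heI hV hw hw').trans ?_
    rw [hconv, Fintype.card_coe, show (4 : ℝ≥0∞) = ENNReal.ofReal 4 by simp,
      ← ENNReal.ofReal_mul (by norm_num)]
    refine ENNReal.ofReal_le_ofReal ?_
    linarith
  exact ⟨I, hI, fun V _ hV => ⟨hfin u hu hu' (by linarith [hle v hv]) V hV,
    hfin v hv hv' (by linarith [hle u hu]) V hV⟩⟩

/-- The Cayley transform of a self-adjoint operator, with the transfer of commutators. -/
theorem exists_cayley {A : H →L[ℂ] H} (hA : IsSelfAdjoint A) :
    ∃ (u : H →L[ℂ] H) (C : ℝ), 0 ≤ C ∧ ContinuousLinearMap.adjoint u * u = 1 ∧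
      u * ContinuousLinearMap.adjoint u = 1 ∧
      (∀ X : H →L[ℂ] H, ∃ X' : H →L[ℂ] H, ‖X'‖ ≤ C * ‖X‖ ∧ X * u - u * X = X' * A - A * X') ∧
      ∀ P : H →L[ℂ] H, hsSq (A * P - P * A) ≤ ENNReal.ofReal C * hsSq (u * P - P * u) := by
  have hunit : IsUnit (A + Complex.I • (1 : H →L[ℂ] H)) := by
    have h1 : -Complex.I ∉ spectrum ℂ A := fun h => by
      have := hA.mem_spectrum_eq_re h
      have := congrArg Complex.im this
      simp at this
    rw [spectrum.notMem_iff] at h1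
    have h2 := h1.neg
    rwa [show -((algebraMap ℂ (H →L[ℂ] H)) (-Complex.I) - A) = A + Complex.I • (1 : H →L[ℂ] H) by
      rw [Algebra.algebraMap_eq_smul_one, neg_smul]; abel] at h2
  obtain ⟨q, hq⟩ := hunit
  set r : H →L[ℂ] H := ↑q⁻¹ with hr
  have hqr : (A + Complex.I • (1 : H →L[ℂ] H)) * r = 1 := by rw [← hq, hr, Units.mul_inv]
  have hrq : r * (A + Complex.I • (1 : H →L[ℂ] H)) = 1 := by rw [← hq, hr, Units.inv_mul]
  have hAr : A * r = 1 - Complex.I • r := by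
    rw [add_mul, smul_mul_assoc, one_mul] at hqr
    exact eq_sub_of_add_eq hqr
  have hrA : r * A = 1 - Complex.I • r := by
    rw [mul_add, mul_smul_comm, mul_one] at hrq
    exact eq_sub_of_add_eq hrq
  have hAs : star A = A := hA
  have hsAr : A * star r = 1 + Complex.I • star r := by
    have := congrArg star hrA
    simpa [hAs, sub_neg_eq_add] using this
  have hsrA : star r * A = 1 + Complex.I • star r := by
    have := congrArg star hAr
    simpa [hAs, sub_neg_eq_add] using this
  have hrel : r - star r = (-2 * Complex.I) • (star r * r) := by
    have h1 : star r * A * r = star r * (1 - Complex.I • r) := by rw [mul_assoc, hAr]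
    rw [hsrA, add_mul, one_mul, mul_sub, mul_one, smul_mul_assoc, mul_smul_comm] at h1
    linear_combination (norm := module) h1
  have hrel' : r - star r = (-2 * Complex.I) • (r * star r) := by
    have h1 : r * A * star r = r * (1 + Complex.I • star r) := by rw [mul_assoc, hsAr]
    rw [hrA, sub_mul, one_mul, mul_add, mul_one, smul_mul_assoc, mul_smul_comm] at h1
    linear_combination (norm := module) -h1
  -- With `r = (A + i)⁻¹` this is `(A - i)(A + i)⁻¹`. In the constant below, `2‖r‖²` serves
  -- commutators passing from `u` to `A`, and `‖A + i‖⁴` serves Hilbert-Schmidt bounds passing back.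
  set u : H →L[ℂ] H := 1 - (2 * Complex.I) • r with hu
  have hus : ContinuousLinearMap.adjoint u = 1 + (2 * Complex.I) • star r := by
    rw [← ContinuousLinearMap.star_eq_adjoint, hu]
    simp [sub_neg_eq_add]
  have hcomm (X : H →L[ℂ] H) : X * r - r * X = A * (r * X * r) - r * X * r * A := by
    have e1 : A * (r * X * r) = (A * r) * (X * r) := by simp only [mul_assoc]
    have e2 : r * X * r * A = r * X * (r * A) := by simp only [mul_assoc]
    rw [e1, e2, hAr, hrA]
    simp only [sub_mul, mul_sub, one_mul, mul_one, smul_mul_assoc, mul_smul_comm, mul_assoc]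
    abel
  refine ⟨u, 2 * ‖r‖ ^ 2 + ‖(q : H →L[ℂ] H)‖ ^ 4, by positivity, ?_, ?_, fun X => ?_, fun P => ?_⟩
  · rw [hus, hu]
    have : (1 + (2 * Complex.I) • star r) * (1 - (2 * Complex.I) • r) =
        1 - (2 * Complex.I) • ((r - star r) + (2 * Complex.I) • (star r * r)) := by
      simp only [add_mul, mul_sub, one_mul, mul_one, smul_mul_assoc, mul_smul_comm]
      module
    rw [this, hrel, ← add_smul]
    simp
  · rw [hus, hu]
    have : (1 - (2 * Complex.I) • r) * (1 + (2 * Complex.I) • star r) =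
        1 - (2 * Complex.I) • ((r - star r) + (2 * Complex.I) • (r * star r)) := by
      simp only [sub_mul, mul_add, one_mul, mul_one, smul_mul_assoc, mul_smul_comm]
      module
    rw [this, hrel', ← add_smul]
    simp
  · refine ⟨(2 * Complex.I) • (r * X * r), ?_, ?_⟩
    · rw [norm_smul]
      have h1 : ‖r * X * r‖ ≤ ‖r‖ * ‖X‖ * ‖r‖ :=
        (norm_mul_le _ _).trans (mul_le_mul_of_nonneg_right (norm_mul_le _ _) (norm_nonneg _))
      have h2 : ‖(2 * Complex.I : ℂ)‖ = 2 := by simp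
      rw [h2]
      have h3 : 0 ≤ ‖(q : H →L[ℂ] H)‖ ^ 4 * ‖X‖ := by positivity
      nlinarith
    · have : X * u - u * X = -((2 * Complex.I) • (X * r - r * X)) := by
        rw [hu]
        simp only [sub_mul, mul_sub, one_mul, mul_one, smul_mul_assoc, mul_smul_comm]
        module
      rw [this, hcomm]
      simp only [smul_mul_assoc, mul_smul_comm]
      module
  · set Q : H →L[ℂ] H := A + Complex.I • (1 : H →L[ℂ] H) with hQ
    have h1 : A * P - P * A = -(Complex.I / 2) • (Q * ((u * P - P * u) * Q)) := by
      have e1 : u * P - P * u = -((2 * Complex.I) • (r * P - P * r)) := by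
        rw [hu]
        simp only [sub_mul, mul_sub, one_mul, mul_one, smul_mul_assoc, mul_smul_comm]
        module
      have e2 : Q * ((r * P - P * r) * Q) = P * Q - Q * P := by
        calc Q * ((r * P - P * r) * Q) = (Q * r) * P * Q - Q * P * (r * Q) := by noncomm_ring
          _ = _ := by rw [hqr, hrq, one_mul, mul_one]
      have e3 : A * P - P * A = Q * P - P * Q := by
        rw [hQ]
        simp only [add_mul, mul_add, smul_mul_assoc, mul_smul_comm, one_mul, mul_one]
        abel
      have e4 : Complex.I / 2 * (2 * Complex.I) = -1 := by
        rw [div_mul_eq_mul_div, mul_left_comm, Complex.I_mul_I]; norm_num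
      rw [e1, neg_mul, mul_neg, smul_mul_assoc, mul_smul_comm, e2, e3, neg_smul, smul_neg, neg_neg,
        smul_smul, e4]
      simp
    rw [h1, hsSq_smul]
    calc _ ≤ 1 * (‖Q‖ₑ ^ 2 * (‖Q‖ₑ ^ 2 * hsSq (u * P - P * u))) := by
          gcongr
          · refine pow_le_one₀ zero_le ?_
            rw [← ofReal_norm, ENNReal.ofReal_le_one]
            simp
            norm_num
          · refine (hsSq_mul_le_left _ _).trans ?_
            gcongr
            exact hsSq_mul_le_right _ _
      _ = ENNReal.ofReal (‖Q‖ ^ 4) * hsSq (u * P - P * u) := by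
          rw [one_mul, ← mul_assoc, ← pow_add, ENNReal.ofReal_pow (norm_nonneg _), ofReal_norm]
      _ ≤ _ := by
          gcongr
          rw [hq]
          exact le_add_of_nonneg_left (by positivity)

end FiniteOperators

/-! ### Følner subspaces orthogonal to, then containing, a given subspace. -/

namespace FiniteOperators

variable {H : Type*} [NormedAddCommGroup H] [InnerProductSpace ℂ H]

theorem starProjection_sup_of_isOrtho {U V : Submodule ℂ H} [U.HasOrthogonalProjection]
    [V.HasOrthogonalProjection] [(U ⊔ V).HasOrthogonalProjection] (h : U ⟂ V) :
    (U ⊔ V).starProjection = U.starProjection + V.starProjection := by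
  ext x
  refine Submodule.eq_starProjection_of_mem_orthogonal ?_ ?_
  · exact add_mem (Submodule.mem_sup_left (U.starProjection_apply_mem x))
      (Submodule.mem_sup_right (V.starProjection_apply_mem x))
  · rw [add_apply, ← Submodule.inf_orthogonal, Submodule.mem_inf]
    constructor
    · rw [← sub_sub]
      exact sub_mem (Submodule.sub_starProjection_mem_orthogonal x)
        (h.symm (V.starProjection_apply_mem x))
    · rw [add_comm, ← sub_sub]
      exact sub_mem (Submodule.sub_starProjection_mem_orthogonal x)
        (h (U.starProjection_apply_mem x))

theorem commutator_add_smul (A B P : H →L[ℂ] H) (c : ℂ) :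
    (A + c • B) * P - P * (A + c • B) = (A * P - P * A) + c • (B * P - P * B) := by
  simp only [add_mul, mul_add, smul_mul_assoc, mul_smul_comm, smul_sub]
  abel

theorem two_mul_ofReal_add_two_mul_ofReal {a b : ℝ} (ha : 0 ≤ a) (hb : 0 ≤ b) :
    2 * ENNReal.ofReal a + 2 * ENNReal.ofReal b = ENNReal.ofReal (2 * a + 2 * b) := by
  rw [ENNReal.ofReal_add (by positivity) (by positivity), ENNReal.ofReal_mul (by norm_num),
    ENNReal.ofReal_mul (by norm_num), ENNReal.ofReal_ofNat]

theorem finrank_sup_of_isOrtho {U V : Submodule ℂ H} [FiniteDimensional ℂ U]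
    [FiniteDimensional ℂ V] (h : U ⟂ V) :
    Module.finrank ℂ ↥(U ⊔ V) = Module.finrank ℂ U + Module.finrank ℂ V := by
  rw [← Submodule.finrank_sup_add_finrank_inf_eq, h.disjoint.eq_bot, finrank_bot, add_zero]

variable [CompleteSpace H]

theorem hsSq_commutator_sup_le (T : H →L[ℂ] H) {U V : Submodule ℂ H} [U.HasOrthogonalProjection]
    [V.HasOrthogonalProjection] [(U ⊔ V).HasOrthogonalProjection] (h : U ⟂ V) :
    hsSq (T * (U ⊔ V).starProjection - (U ⊔ V).starProjection * T) ≤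
      2 * hsSq (T * U.starProjection - U.starProjection * T) +
        2 * hsSq (T * V.starProjection - V.starProjection * T) := by
  refine le_trans (le_of_eq ?_) (hsSq_add_le _ _)
  rw [starProjection_sup_of_isOrtho h]
  congr 1
  noncomm_ring

/-- A hermitian functional nearly vanishing on commutators with `T` does so on those with `T*`,
because `XT* - T*X = -(X*T - TX*)*`. The values `c = 1` and `c = -1` give the real part and `i`
times the imaginary part. -/
theorem norm_apply_commutator_re_im_le {φ : StrongDual ℂ (H →L[ℂ] H)}
    (hφ : ∀ Y, φ (star Y) = (starRingEnd ℂ) (φ Y)) {T : H →L[ℂ] H} {ε : ℝ}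
    (h : ∀ X, ‖φ (X * T - T * X)‖ ≤ ε * ‖X‖) {c : ℂ} (hc : ‖c‖ ≤ 1) (X : H →L[ℂ] H) :
    ‖φ (X * ((1 / 2 : ℂ) • (T + c • star T)) - ((1 / 2 : ℂ) • (T + c • star T)) * X)‖ ≤
      ε * ‖X‖ := by
  have h1 : X * ((1 / 2 : ℂ) • (T + c • star T)) - ((1 / 2 : ℂ) • (T + c • star T)) * X =
      (1 / 2 : ℂ) • ((X * T - T * X) - c • star (star X * T - T * star X)) := by
    simp only [mul_smul_comm, smul_mul_assoc, mul_add, add_mul, star_sub, star_mul, star_star]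
    module
  have h2 : ‖φ (star (star X * T - T * star X))‖ ≤ ε * ‖X‖ := by
    rw [hφ, RCLike.norm_conj]
    simpa using h (star X)
  rw [h1, map_smul, map_sub, map_smul, norm_smul]
  have h3 := norm_sub_le (φ (X * T - T * X)) (c • φ (star (star X * T - T * star X)))
  rw [norm_smul] at h3
  have h4 := mul_le_of_le_one_left (norm_nonneg (φ (star (star X * T - T * star X)))) hc
  have h5 : ‖(1 / 2 : ℂ)‖ = 1 / 2 := by simp
  rw [h5]
  linarith [h X]

theorem IsFiniteOperator.exists_isFolnerSubspace_le_orthogonal {T : H →L[ℂ] H}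
    (hT : IsFiniteOperator T) (hred : ¬ IsFiniteBlockReducible T) (F : Submodule ℂ H)
    [FiniteDimensional ℂ F] {ε : ℝ} (hε : 0 < ε) :
    ∃ V : Submodule ℂ H, V ≤ Fᗮ ∧ IsFolnerSubspace T ε V := by
  set A : H →L[ℂ] H := (1 / 2 : ℂ) • (T + (1 : ℂ) • star T) with hA
  set B' : H →L[ℂ] H := (1 / 2 : ℂ) • (T + (-1 : ℂ) • star T) with hB'
  set B : H →L[ℂ] H := (-Complex.I) • B' with hB
  have hTAB : T = A + Complex.I • B := by
    rw [hB, smul_smul, mul_neg, Complex.I_mul_I, neg_neg, one_smul, hA, hB']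
    module
  have hAsa : IsSelfAdjoint A := by
    rw [isSelfAdjoint_iff, hA]
    simp [add_comm]
  have hBsa : IsSelfAdjoint B := by
    rw [isSelfAdjoint_iff, hB, hB']
    simp only [star_smul, star_add, star_star, star_neg, star_one, star_div₀, star_ofNat,
      Complex.star_def, Complex.conj_I]
    module
  obtain ⟨u, C, hC, hu, hu', huX, huP⟩ := exists_cayley hAsa
  obtain ⟨v, D, hD, hv, hv', hvX, hvP⟩ := exists_cayley hBsa
  -- The factor `32` is the final `2 * 16`, from `hsSq_add_le` and the bound `16 * t`. Below,
  -- dividing `t ^ 2` by `C + D + 1` compensates the norm growth of `X'` in the Cayley transfer.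
  obtain ⟨t, htpos, ht1, htε⟩ : ∃ t : ℝ, 0 < t ∧ t ≤ 1 ∧ t * (32 * (C + D + 1)) ≤ ε :=
    ⟨min 1 (ε / (32 * (C + D + 1))), lt_min one_pos (by positivity), min_le_left _ _,
      (le_div_iff₀ (by positivity)).mp (min_le_right _ _)⟩
  obtain ⟨m, x, hxF, hx1, hx⟩ := hT.exists_almost_commuting_density hred F
    (ε := t ^ 2 / (C + D + 1)) (by positivity)
  obtain ⟨n, e, d, he, hex, hd, hY⟩ := exists_orthonormal_sum_inner_eq x
  let φ : StrongDual ℂ (H →L[ℂ] H) := ∑ i, (d i : ℂ) • innerFunctional (e i) (e i)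
  have hφval (Y) : φ Y = ∑ i, d i * ⟪e i, Y (e i)⟫_ℂ := by
    simp [φ, sum_apply, innerFunctional_apply]
  have hφstar (Y : H →L[ℂ] H) : φ (star Y) = (starRingEnd ℂ) (φ Y) := by
    rw [hφval, hφval, map_sum]
    refine Finset.sum_congr rfl fun i _ => ?_
    rw [map_mul, Complex.conj_ofReal, inner_conj_symm, ContinuousLinearMap.star_eq_adjoint,
      ContinuousLinearMap.adjoint_inner_right]
  have hφT (X) : ‖φ (X * T - T * X)‖ ≤ t ^ 2 / (C + D + 1) * ‖X‖ := by
    rw [hφval, ← hY]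
    exact hx X
  have hd1 : ∑ i, d i = 1 := by
    have h1 := hY 1
    simp only [one_apply_eq_self, inner_self_eq_norm_sq_to_K, he.norm_eq_one] at h1
    have h2 : ((∑ k, ‖x k‖ ^ 2 : ℝ) : ℂ) = ((∑ i, d i : ℝ) : ℂ) := by
      push_cast
      simpa using h1
    rw [← hx1]
    exact (Complex.ofReal_injective h2).symm
  have hφA (X) := norm_apply_commutator_re_im_le hφstar hφT (c := 1) (by simp) X
  have hφB (X : H →L[ℂ] H) : ‖φ (X * B - B * X)‖ ≤ t ^ 2 / (C + D + 1) * ‖X‖ := by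
    have h1 := norm_apply_commutator_re_im_le hφstar hφT (c := -1) (by simp) X
    have h2 : X * B - B * X = (-Complex.I) • (X * B' - B' * X) := by
      rw [hB, mul_smul_comm, smul_mul_assoc, smul_sub]
    rw [h2, map_smul, norm_smul, norm_neg, Complex.norm_I, one_mul]
    exact h1
  have htransfer {w S : H →L[ℂ] H} {E : ℝ} (hE : E ≤ C + D + 1)
      (hw : ∀ X : H →L[ℂ] H, ∃ X' : H →L[ℂ] H, ‖X'‖ ≤ E * ‖X‖ ∧
        X * w - w * X = X' * S - S * X')
      (hS : ∀ X, ‖φ (X * S - S * X)‖ ≤ t ^ 2 / (C + D + 1) * ‖X‖) (X : H →L[ℂ] H) :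
      ‖∑ i, d i * ⟪e i, (X * w - w * X) (e i)⟫_ℂ‖ ≤ t ^ 2 * ‖X‖ := by
    obtain ⟨X', hX', hXX'⟩ := hw X
    rw [← hφval, hXX']
    refine (hS X').trans ?_
    rw [div_mul_eq_mul_div, div_le_iff₀ (by positivity), mul_assoc]
    refine mul_le_mul_of_nonneg_left ?_ (sq_nonneg t)
    refine hX'.trans ?_
    rw [mul_comm ‖X‖]
    exact mul_le_mul_of_nonneg_right hE (norm_nonneg X)
  obtain ⟨I, hI, hIV⟩ := exists_subfamily_almost_commuting he hd hd1 hu hu' hv hv' htpos ht1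
    (htransfer (by linarith) huX hφA) (htransfer (by linarith) hvX hφB)
  have heI : Orthonormal ℂ fun i : I => e i := he.comp _ Subtype.coe_injective
  set V := Submodule.span ℂ (Set.range fun i : I => e i) with hV
  have hVfin : FiniteDimensional ℂ V := FiniteDimensional.span_of_finite ℂ (Set.finite_range _)
  have hrank : Module.finrank ℂ V = I.card := by
    rw [hV, finrank_span_eq_card heI.linearIndependent, Fintype.card_coe]
  obtain ⟨h1, h2⟩ := hIV V hV.symm
  refine ⟨V, ?_, hVfin, ?_, ?_⟩
  · rw [hV, Submodule.span_le]
    rintro _ ⟨i, rfl⟩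
    have hle : Submodule.span ℂ (Set.range x) ≤ Fᗮ := by
      rw [Submodule.span_le]
      rintro _ ⟨k, rfl⟩
      exact hxF k
    exact hle (hex i)
  · rw [← Submodule.nontrivial_iff_ne_bot, ← Module.finrank_pos_iff (R := ℂ), hrank]
    exact hI.card_pos
  · set P := V.starProjection
    have h3 : T * P - P * T = (A * P - P * A) + Complex.I • (B * P - P * B) := by
      calc T * P - P * T = (A + Complex.I • B) * P - P * (A + Complex.I • B) := by rw [← hTAB]
        _ = _ := commutator_add_smul A B P Complex.I
    have h4 : ‖Complex.I‖ₑ = 1 := by rw [← ofReal_norm, Complex.norm_I, ENNReal.ofReal_one]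
    rw [h3, hrank]
    refine (hsSq_add_le _ _).trans ?_
    rw [hsSq_smul, h4, one_pow, one_mul]
    have hN : (0 : ℝ) ≤ I.card := Nat.cast_nonneg _
    generalize (I.card : ℝ) = N at h1 h2 hN ⊢
    have h5 : 0 ≤ 16 * t * N := mul_nonneg (mul_nonneg (by norm_num) htpos.le) hN
    calc _ ≤ 2 * (ENNReal.ofReal C * ENNReal.ofReal (16 * t * N)) +
        2 * (ENNReal.ofReal D * ENNReal.ofReal (16 * t * N)) := by
          gcongr
          · exact (huP P).trans (mul_le_mul_right h1 _)
          · exact (hvP P).trans (mul_le_mul_right h2 _)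
      _ = ENNReal.ofReal (2 * (C * (16 * t * N)) + 2 * (D * (16 * t * N))) := by
          rw [← two_mul_ofReal_add_two_mul_ofReal (mul_nonneg hC h5) (mul_nonneg hD h5),
            ENNReal.ofReal_mul hC, ENNReal.ofReal_mul hD]
      _ ≤ _ := by
          refine ENNReal.ofReal_le_ofReal ?_
          calc _ = (t * (32 * (C + D))) * N := by ring
            _ ≤ ε * N := mul_le_mul_of_nonneg_right (by linarith) hN

/-- Mutually orthogonal Følner subspaces are stacked, each adding at least one dimension; `ε` is
halved each time to pay for the factor `2` in `hsSq_commutator_sup_le`. -/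
theorem IsFiniteOperator.exists_large_isFolnerSubspace_le_orthogonal {T : H →L[ℂ] H}
    (hT : IsFiniteOperator T) (hred : ¬ IsFiniteBlockReducible T) (m : ℕ) :
    ∀ (F : Submodule ℂ H) [FiniteDimensional ℂ F] {ε : ℝ}, 0 < ε →
      ∃ V : Submodule ℂ H, V ≤ Fᗮ ∧ IsFolnerSubspace T ε V ∧ m ≤ Module.finrank ℂ V := by
  induction m with
  | zero =>
    intro F _ ε hε
    obtain ⟨V, hV, hVε⟩ := hT.exists_isFolnerSubspace_le_orthogonal hred F hε
    exact ⟨V, hV, hVε, Nat.zero_le _⟩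
  | succ m ih =>
    intro F _ ε hε
    obtain ⟨V, hVF, ⟨hVfin, hV0, hV⟩, hm⟩ := ih F (half_pos hε)
    obtain ⟨V', hVF', hVfin', hV0', hV'⟩ :=
      hT.exists_isFolnerSubspace_le_orthogonal hred (F ⊔ V) (half_pos hε)
    have horth : V ⟂ V' := ((Submodule.isOrtho_sup_right.mp hVF').2).symm
    have hF' : V' ≤ Fᗮ := (Submodule.isOrtho_sup_right.mp hVF').1
    have hpos' : 0 < Module.finrank ℂ V' := by
      rw [Module.finrank_pos_iff]
      exact Submodule.nontrivial_iff_ne_bot.mpr hV0'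
    refine ⟨V ⊔ V', sup_le hVF hF', ⟨inferInstance, ?_, ?_⟩, ?_⟩
    · exact fun h => hV0 (le_bot_iff.mp (h ▸ le_sup_left))
    · refine (hsSq_commutator_sup_le T horth).trans ?_
      rw [finrank_sup_of_isOrtho horth]
      calc _ ≤ 2 * ENNReal.ofReal (ε / 2 * Module.finrank ℂ V) +
            2 * ENNReal.ofReal (ε / 2 * Module.finrank ℂ V') := by gcongr
        _ = ENNReal.ofReal (2 * (ε / 2 * Module.finrank ℂ V) +
            2 * (ε / 2 * Module.finrank ℂ V')) := by
          rw [two_mul_ofReal_add_two_mul_ofReal (by positivity) (by positivity)]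
        _ = _ := by
          congr 1
          push_cast
          ring
    · rw [finrank_sup_of_isOrtho horth]
      omega

theorem hsSq_commutator_starProjection_ne_top (T : H →L[ℂ] H) (F : Submodule ℂ H)
    [FiniteDimensional ℂ F] : hsSq (T * F.starProjection - F.starProjection * T) ≠ ⊤ := by
  have h : hsSq F.starProjection ≠ ⊤ := by rw [hsSq_starProjection]; simp
  have h1 : ‖T‖ₑ ^ 2 * hsSq F.starProjection ≠ ⊤ :=
    ENNReal.mul_ne_top (by simp) h
  refine ne_top_of_le_ne_top ?_ ((hsSq_sub_le _ _).trans (add_le_add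
    (mul_le_mul_right (hsSq_mul_le_left _ _) 2) (mul_le_mul_right (hsSq_mul_le_right _ _) 2)))
  exact ENNReal.add_ne_top.mpr ⟨ENNReal.mul_ne_top (by simp) h1, ENNReal.mul_ne_top (by simp) h1⟩

/-- The commutator with the projection onto `F` has a fixed finite Hilbert-Schmidt norm, so adding a
sufficiently large Følner subspace of `Fᗮ` makes its relative size negligible. -/
theorem IsFiniteOperator.exists_isFolnerSubspace_ge {T : H →L[ℂ] H}
    (hT : IsFiniteOperator T) (hred : ¬ IsFiniteBlockReducible T) (F : Submodule ℂ H)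
    [FiniteDimensional ℂ F] {ε : ℝ} (hε : 0 < ε) :
    ∃ V : Submodule ℂ H, F ≤ V ∧ IsFolnerSubspace T ε V := by
  set C := (hsSq (T * F.starProjection - F.starProjection * T)).toReal with hC
  have hC0 : 0 ≤ C := ENNReal.toReal_nonneg
  obtain ⟨m, hm⟩ := exists_nat_ge (2 * C / (ε / 2))
  obtain ⟨V, hVF, ⟨hVfin, hV0, hV⟩, hmV⟩ :=
    hT.exists_large_isFolnerSubspace_le_orthogonal hred m F (ε := ε / 4) (by positivity)
  have horth : F ⟂ V := Submodule.IsOrtho.symm hVF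
  refine ⟨F ⊔ V, le_sup_left, inferInstance, ?_, ?_⟩
  · exact fun h => hV0 (le_bot_iff.mp (h ▸ le_sup_right))
  · refine (hsSq_commutator_sup_le T horth).trans ?_
    rw [finrank_sup_of_isOrtho horth,
      ← ENNReal.ofReal_toReal (hsSq_commutator_starProjection_ne_top T F), ← hC]
    calc _ ≤ 2 * ENNReal.ofReal C + 2 * ENNReal.ofReal (ε / 4 * Module.finrank ℂ V) := by gcongr
      _ = ENNReal.ofReal (2 * C + 2 * (ε / 4 * Module.finrank ℂ V)) := by
          rw [two_mul_ofReal_add_two_mul_ofReal (by positivity) (by positivity)]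
      _ ≤ _ := by
          refine ENNReal.ofReal_le_ofReal ?_
          rw [div_le_iff₀ (by positivity)] at hm
          have h1 : (m : ℝ) ≤ Module.finrank ℂ V := by exact_mod_cast hmV
          have h2 : (0 : ℝ) ≤ Module.finrank ℂ F := Nat.cast_nonneg _
          push_cast
          nlinarith

theorem hasProperFolnerSequence_of_forall_exists_isFolnerSubspace
    [TopologicalSpace.SeparableSpace H] {T : H →L[ℂ] H}
    (h : ∀ (F : Submodule ℂ H) [FiniteDimensional ℂ F] (ε : ℝ), 0 < ε →
      ∃ V : Submodule ℂ H, F ≤ V ∧ IsFolnerSubspace T ε V) : HasProperFolnerSequence T := by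
  have hstep (n : ℕ) (F : {F : Submodule ℂ H // FiniteDimensional ℂ F}) :
      ∃ V : {F : Submodule ℂ H // FiniteDimensional ℂ F}, F.1 ≤ V.1 ∧
        TopologicalSpace.denseSeq H n ∈ V.1 ∧ IsFolnerSubspace T (1 / ((n : ℝ) + 1)) V.1 := by
    have := F.2
    obtain ⟨V, hFV, hV⟩ := h (F.1 ⊔ Submodule.span ℂ {TopologicalSpace.denseSeq H n})
      (1 / ((n : ℝ) + 1)) (by positivity)
    exact ⟨⟨V, hV.1⟩, le_sup_left.trans hFV,
      hFV (Submodule.mem_sup_right (Submodule.mem_span_singleton_self _)), hV⟩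
  choose g hg1 hg2 hg3 using hstep
  -- The recursion starts at `⊥`, which is not a Følner subspace, so the sequence is shifted by one;
  -- `V n` then also contains the `n`-th term of the dense sequence.
  let W : ℕ → {F : Submodule ℂ H // FiniteDimensional ℂ F} := fun n =>
    Nat.rec ⟨⊥, inferInstance⟩ (fun n V => g n V) n
  let V : ℕ → Submodule ℂ H := fun n => (W (n + 1)).1
  have hVfin (n) : FiniteDimensional ℂ (V n) := (W (n + 1)).2
  have hVmono : Monotone V := monotone_nat_of_le_succ fun n => hg1 (n + 1) (W (n + 1))
  have hVmem (n) : TopologicalSpace.denseSeq H n ∈ V n := hg2 n (W n)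
  have hVF (n : ℕ) : IsFolnerSubspace T (1 / ((n : ℝ) + 1)) (V n) := hg3 n (W n)
  refine ⟨fun n => (V n).starProjection, ⟨fun n => ⟨?_, ?_, ?_⟩, ?_⟩, ?_, ?_⟩
  · obtain ⟨-, hne, -⟩ := hVF n
    intro h0
    refine hne ?_
    change (V n).starProjection = 0 at h0
    rw [← Submodule.range_starProjection (V n), h0]
    exact LinearMap.range_zero
  · exact isStarProjection_starProjection
  · rw [Submodule.range_starProjection]
    exact hVfin n
  · rintro _ rfl
    have hlim : Tendsto (fun n : ℕ => ENNReal.ofReal (1 / ((n : ℝ) + 1)) ^ (1 / 2 : ℝ)) atTop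
        (𝓝 0) := by
      have h1 := (ENNReal.continuous_ofReal.tendsto 0).comp
        (tendsto_one_div_add_atTop_nhds_zero_nat (𝕜 := ℝ))
      have h2 := ((ENNReal.continuous_rpow_const (y := 1 / 2)).tendsto _).comp h1
      simpa [Function.comp_def] using h2
    refine tendsto_of_tendsto_of_tendsto_of_le_of_le tendsto_const_nhds hlim
      (fun n => zero_le) fun n => ?_
    obtain ⟨_, -, hle⟩ := hVF n
    refine ENNReal.div_le_of_le_mul ?_
    rw [hsNorm_starProjection, hsNorm_eq_rpow, ← ENNReal.mul_rpow_of_nonneg _ _ (by norm_num)]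
    refine ENNReal.rpow_le_rpow ?_ (by norm_num)
    rwa [ENNReal.ofReal_mul (by positivity), ENNReal.ofReal_natCast] at hle
  · exact fun m n hmn => Submodule.starProjection_le_starProjection_iff.mpr (hVmono hmn)
  · intro x
    refine Submodule.starProjection_tendsto_self V hVmono x ?_
    intro y _
    rw [← SetLike.mem_coe, Submodule.topologicalClosure_coe]
    refine closure_mono ?_ (TopologicalSpace.denseRange_denseSeq H y)
    rintro _ ⟨n, rfl⟩
    exact Submodule.mem_iSup_of_mem n (hVmem n)

end FiniteOperators

theorem theorem4p1 {H : Type*} [NormedAddCommGroup H] [InnerProductSpace ℂ H] [CompleteSpace H]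
    [TopologicalSpace.SeparableSpace H] (T : H →L[ℂ] H) :
    FiniteOperators.IsFiniteOperator T ↔
      FiniteOperators.IsFiniteBlockReducible T ∨ FiniteOperators.HasProperFolnerSequence T := by
  constructor
  · intro hT
    by_cases hred : FiniteOperators.IsFiniteBlockReducible T
    · exact Or.inl hred
    · exact Or.inr <| FiniteOperators.hasProperFolnerSequence_of_forall_exists_isFolnerSubspace
        fun F _ ε hε => hT.exists_isFolnerSubspace_ge hred F hε
  · rintro (h | h)
    · exact FiniteOperators.isFiniteOperator_of_isFolnerSubspace fun ε _ => h.isFolnerSubspace ε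
    · exact FiniteOperators.isFiniteOperator_of_isFolnerSubspace fun ε hε => h.isFolnerSubspace hε
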